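/- Let $(W,S)$ be a finite Weyl group (a finite Coxeter group in which the product of any two distinct generators has order $2,3,4$ or $6$) with length function $l$, and let $L\colon W\to\mathbb{N}$ be a weight function, i.e. $L(ww')=L(w)+L(w')$ whenever $l(ww')=l(w)+l(w')$. Let $A=\mathbb{Z}[v,v^{-1}]$, and let $\mathbf{H}$ be the generic Iwahori–Hecke algebra: the associative $A$-algebra with basis $\{T_w\mid w\in W\}$ and, for $s\in S$, $T_sT_w=T_{sw}$ if $l(sw)>l(w)$ and $T_sT_w=v^{2L(s)}T_{sw}+(v^{2L(s)}-1)T_w$ if $l(sw)<l(w)$. Put $\tilde T_w=v^{-L(w)}T_w$; let $h\mapsto \bar h$ be the map $\sum a_w\tilde T_w\mapsto\sum \bar a_w\tilde T_{w^{-1}}^{-1}$ (with $\bar a(v)=a(v^{-1})$) and let $h\mapsto h^\dagger$ be the $A$-linear map with $\tilde T_w^\dagger=(-1)^{l(w)}\tilde T_{w^{-1}}^{-1}$. Let $\{c_w\}$ be the Kazhdan–Lusztig basis: $\bar c_w=c_w$ and $c_w-\tilde T_w$ is a $v^{-1}\mathbb{Z}[v^{-1}]$-linear combination of the $\tilde T_y$.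 Write $c_xc_y=\sum_z h_{x,y,z}c_z$; let $\mathbf{a}(z)$ be the least $i\ge 0$ with $v^ih_{x,y,z}\in\mathbb{Z}[v]$ for all $x,y\in W$, and let $\gamma_{x,y,z}$ be the constant term of $v^{\mathbf{a}(z)}h_{x,y,z^{-1}}$. Let $\tau\colon\mathbf H\to A$ be the $A$-linear map with $\tau(T_1)=1$ and $\tau(T_w)=0$ for $w\ne1$. If $\tau(c_z)\neq 0$, let $n_zv^{-\Delta(z)}$ be the term of highest degree of $\tau(c_z)$; if $\tau(c_z)=0$, put $\Delta(z)=\infty$. Let $\mathcal{D}=\{z\mid \mathbf{a}(z)=\Delta(z)\}$. Assume Lusztig's properties: - P2: if $d\in\mathcal D$ and $\gamma_{x,y,d}\ne0$ then $x=y^{-1}$. - P3: for each $y$ there is a unique $d\in\mathcal D$ with $\gamma_{y^{-1},y,d}\neq0$. - P4: if $h_{x,y,z}\ne0$ then $\mathbf a(z)\ge\mathbf a(x)$ and $\mathbf a(z)\geq\mathbf a(y)$. - P5: if $d\in\mathcal D$ and $\gamma_{y^{-1},y,d}\ne0$ then $\gamma_{y^{-1},y,d}=n_d=\pm1$. - P6: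 $d^2=1$ for $d\in\mathcal D$. - P7: $\gamma_{x,y,z}=\gamma_{y,z,x}$. - P8: if $\gamma_{x,y,z}\ne0$ then $\mathbf a(x)=\mathbf a(y)=\mathbf a(z)$. - P15$'$: if $\mathbf a(w)=\mathbf a(y)$ then $\sum_u h_{x,u,y}\gamma_{w,x',u^{-1}}=\sum_u h_{x,w,u}\gamma_{u,x',y^{-1}}$. Put $\hat n_z=n_d$, where $d\in\mathcal D$ is the unique element with $\gamma_{z,z^{-1},d}\ne0$. Let $k$ be a field, $\theta\colon A\to k$ a ring homomorphism, $\xi=\theta(v^2)$, $\mathbf H_{k,\xi}=k\otimes_A\mathbf H$, and let $\mathbf J_k$ be the $k$-vector space with basis $\{t_w\mid w\in W\}$ (underlying Lusztig's asymptotic ring with scalars extended to $k$). Let $\phi_{k,\xi}\colon\mathbf H_{k,\xi}\to\mathbf J_k$ be the $k$-linear map obtained by applying $\theta$ to $$\phi(c_w^\dagger)=\sum_{z\in W,\ d\in\mathcal D,\ \mathbf a(z)=\mathbf a(d)}h_{w,d,z}\,\hat n_z\,t_z .$$ For $a\ge0$ let $\mathbf H_{k,\xi}^{\ge a}$ be the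 span of the $c_w^\dagger$ with $\mathbf a(w)\ge a$ (a two-sided ideal by P4), let $\mathbf H^a_{k,\xi}=\mathbf H_{k,\xi}^{\ge a}/\mathbf H_{k,\xi}^{\ge a+1}$, write $[f]$ for the class of $f$, and let $\star\colon\mathbf J_k\times\mathbf H^a_{k,\xi}\to\mathbf H^a_{k,\xi}$ be the $k$-bilinear map with $t_x\star[c_w^\dagger]=\sum_z\gamma_{x,w,z^{-1}}\hat n_w\hat n_z[c_z^\dagger]$ for $\mathbf a(w)=a$. For a simple $\mathbf H_{k,\xi}$-module $M$ let $\alpha_M$ be the largest value $\mathbf a(w)$ such that $c_w^\dagger M\neq\{0\}$. Put $a=\alpha_M$ and $\tilde M=\mathbf H^a_{k,\xi}\otimes_{\mathbf H_{k,\xi}}M$, and let ${}^*\!\tilde M$ be $\tilde M$ with $\mathbf H_{k,\xi}$ acting through $\phi_{k,\xi}$, that is, $h\cdot([f]\otimes m)=(\phi_{k,\xi}(h)\star[f])\otimes m$. Then this is a well-defined $\mathbf H_{k,\xi}$-module structure on $\tilde M$, and there is a well-defined map $\pi\colon{}^*\!\tilde M\to M$ with $\pi([f]\otimes m)=f\cdot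 m$ for $f\in\mathbf H_{k,\xi}^{\ge a}$ and $m\in M$, which is a surjective homomorphism of $\mathbf H_{k,\xi}$-modules. Every composition factor $M'$ of $\ker\pi$ satisfies $\alpha_{M'}<\alpha_M$. In particular, ${}^*\!\tilde M$ has a composition series, and $M$ occurs with multiplicity exactly $1$ as a composition factor of ${}^*\!\tilde M$. -/

import Mathlib

noncomputable section

open scoped TensorProduct

namespace IwahoriHecke

/-! ### The exchange condition -/

section Exchange

variable {B W : Type*} [Group W] {M : CoxeterMatrix B} (cs : CoxeterSystem M W)

open Classical in
/-- The permutation `(t, e) ↦ (s t s, e + [t = s])` of `W × ℤ/2`. -/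
def reflFun (i : B) : Function.End (W × ZMod 2) :=
  fun p => (cs.simple i * p.1 * cs.simple i, p.2 + if p.1 = cs.simple i then 1 else 0)

open Classical in
theorem reflFun_mul_pow (i i' : B) (n : ℕ) (t : W) (e : ZMod 2) :
    ((reflFun cs i * reflFun cs i') ^ n) (t, e) =
      ((cs.simple i * cs.simple i') ^ n * t * ((cs.simple i * cs.simple i') ^ n)⁻¹,
        e + ∑ j ∈ Finset.range (2 * n),
          if t = cs.simple i' * (cs.simple i * cs.simple i') ^ j then 1 else 0) := by
  induction n generalizing t e with
  | zero =>
    show (t, e) = _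
    simp
  | succ n ih =>
    have h1 : ((reflFun cs i * reflFun cs i') ^ (n + 1)) (t, e) =
      ((reflFun cs i * reflFun cs i') ^ n) (reflFun cs i (reflFun cs i' (t, e))) := by
      rw [pow_succ]; rfl
    have hi := cs.simple_mul_simple_self i
    have hi' := cs.simple_mul_simple_self i'
    have vi := cs.inv_simple i
    have vi' := cs.inv_simple i'
    rw [h1]
    simp only [reflFun]
    rw [ih]
    refine Prod.ext ?_ ?_
    · simp only [pow_succ, mul_inv_rev, vi, vi', mul_assoc]
    · simp only [show 2 * (n + 1) = 2 * n + 1 + 1 by ring, Finset.sum_range_succ']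
      have e1 : (cs.simple i' * t * cs.simple i' = cs.simple i) ↔
          t = cs.simple i' * (cs.simple i * cs.simple i') ^ (0 + 1) := by
        constructor
        · intro h
          rw [zero_add, pow_one, ← h]
          simp [mul_assoc]
        · rintro rfl
          simp [mul_assoc]
      have e2 : ∀ j : ℕ, (cs.simple i * (cs.simple i' * t * cs.simple i') * cs.simple i =
          cs.simple i' * (cs.simple i * cs.simple i') ^ j) ↔
          t = cs.simple i' * (cs.simple i * cs.simple i') ^ (j + 1 + 1) := by
        intro j
        have e3 : cs.simple i' * (cs.simple i * cs.simple i') ^ (j + 1 + 1) =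
            cs.simple i' * cs.simple i * (cs.simple i' * (cs.simple i * cs.simple i') ^ j)
              * (cs.simple i * cs.simple i') := by
          rw [pow_succ, pow_succ']
          simp only [mul_assoc]
        rw [e3]
        constructor
        · intro h
          rw [← h]
          simp [mul_assoc]
        · intro h
          rw [h]
          simp [mul_assoc]
      simp only [e1, e2, pow_zero, mul_one]
      ring

theorem reflFun_isLiftable : M.IsLiftable (reflFun cs) := by
  classical
  intro i i'
  funext ⟨t, e⟩
  rw [reflFun_mul_pow, two_mul, Finset.sum_range_add]
  simp only [pow_add, cs.simple_mul_simple_pow i i', one_mul, inv_one, mul_one]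
  rw [CharTwo.add_self_eq_zero, add_zero]
  rfl

open Classical in
theorem lift_reflFun_wordProd (ω : List B) (t : W) (e : ZMod 2) :
    cs.lift ⟨reflFun cs, reflFun_isLiftable cs⟩ (cs.wordProd ω) (t, e) =
      (cs.wordProd ω * t * (cs.wordProd ω)⁻¹, e + ((cs.rightInvSeq ω).count t : ZMod 2)) := by
  induction ω with
  | nil => simp [Function.End.one_def]
  | cons i ω ih =>
    have h : cs.lift ⟨reflFun cs, reflFun_isLiftable cs⟩ (cs.wordProd (i :: ω)) (t, e) =
        reflFun cs i
          (cs.lift ⟨reflFun cs, reflFun_isLiftable cs⟩ (cs.wordProd ω) (t, e)) := by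
      rw [cs.wordProd_cons, map_mul, cs.lift_apply_simple]; rfl
    rw [h, ih]
    have e1 : cs.wordProd ω * t * (cs.wordProd ω)⁻¹ = cs.simple i ↔
        (cs.wordProd ω)⁻¹ * cs.simple i * cs.wordProd ω = t := by
      constructor
      · intro h; rw [← h]; group
      · intro h; rw [← h]; group
    refine Prod.ext ?_ ?_
    · simp [reflFun, cs.wordProd_cons, mul_assoc]
    · simp only [reflFun, CoxeterSystem.rightInvSeq, List.count_cons, e1, beq_iff_eq]
      push_cast
      ring

/-- If `s` is a right descent of `w`, then `s` occurs in the right inversion sequence of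
each word for `w`. -/
theorem simple_mem_rightInvSeq {ω : List B} {i : B}
    (hi : cs.length (cs.wordProd ω * cs.simple i) < cs.length (cs.wordProd ω)) :
    cs.simple i ∈ cs.rightInvSeq ω := by
  classical
  by_contra hmem
  obtain ⟨ω', hω', hw'⟩ := cs.exists_isReduced (cs.wordProd ω * cs.simple i)
  have hprod : cs.wordProd (ω'.concat i) = cs.wordProd ω := by
    rw [cs.wordProd_concat, ← hw']; simp
  have hred : cs.IsReduced (ω'.concat i) := by
    unfold CoxeterSystem.IsReduced
    rw [hprod]
    have h1 := cs.length_mul_simple (cs.wordProd ω) i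
    have h2 := hω'.eq
    rw [← hw'] at h2
    simp only [List.length_concat]
    omega
  have h1 := lift_reflFun_wordProd cs ω (cs.simple i) 0
  have h2 := lift_reflFun_wordProd cs (ω'.concat i) (cs.simple i) 0
  rw [hprod, h1] at h2
  have h3 := congrArg Prod.snd h2
  have hc : (cs.rightInvSeq (ω'.concat i)).count (cs.simple i) = 1 := by
    apply List.count_eq_one_of_mem hred.nodup_rightInvSeq
    rw [cs.rightInvSeq_concat]; simp
  simp only [hc, List.count_eq_zero_of_not_mem hmem] at h3
  revert h3; decide

theorem simple_mul_eq_mul_simple_aux {w : W} {i j : B}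
    (h1 : cs.length (cs.simple i * w) = cs.length (w * cs.simple j))
    (h2 : cs.length (cs.simple i * w * cs.simple j) = cs.length w)
    (h3 : cs.length w < cs.length (cs.simple i * w)) :
    cs.simple i * w = w * cs.simple j := by
  obtain ⟨ω, hω, rfl⟩ := cs.exists_isReduced w
  have hred : cs.IsReduced (i :: ω) := by
    unfold CoxeterSystem.IsReduced
    rw [cs.wordProd_cons]
    have := cs.length_simple_mul (cs.wordProd ω) i
    have := hω.eq
    simp only [List.length_cons]
    omega
  have hmem : cs.simple j ∈ cs.rightInvSeq (i :: ω) := by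
    apply simple_mem_rightInvSeq cs
    rw [cs.wordProd_cons]; omega
  rw [CoxeterSystem.rightInvSeq, List.mem_cons] at hmem
  rcases hmem with h | h
  · rw [h]; group
  · have := (cs.isRightInversion_of_mem_rightInvSeq hω h).2
    omega

theorem simple_mul_eq_mul_simple {w : W} {i j : B}
    (h1 : cs.length (cs.simple i * w) = cs.length (w * cs.simple j))
    (h2 : cs.length (cs.simple i * w * cs.simple j) = cs.length w) :
    cs.simple i * w = w * cs.simple j := by
  rcases lt_or_gt_of_ne (cs.length_simple_mul_ne w i) with h | h
  · have := simple_mul_eq_mul_simple_aux cs (w := cs.simple i * w) (i := i) (j := j)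
      (by simpa using h2.symm) (by simpa using h1.symm) (by simpa using h)
    simp only [CoxeterSystem.simple_mul_simple_cancel_left] at this
    rw [mul_assoc] at this
    conv_lhs => rw [this]
    simp
  · exact simple_mul_eq_mul_simple_aux cs h1 h2 h

end Exchange

/-! ### The generic Iwahori–Hecke algebra -/

/-- The ring `A = ℤ[v, v⁻¹]`; the power `v ^ n` is `LaurentPolynomial.T n`. -/
abbrev A : Type := LaurentPolynomial ℤ

/-- The element `v ^ n` of `A`. -/
abbrev v (n : ℤ) : A := LaurentPolynomial.T n

/-- A weight function `L : W → ℕ`: it is additive on reduced products. -/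
structure WeightFunction {B W : Type*} [Group W] {M : CoxeterMatrix B}
    (cs : CoxeterSystem M W) where
  /-- the underlying function -/
  toFun : W → ℕ
  map_mul : ∀ w w' : W, cs.length (w * w') = cs.length w + cs.length w' →
    toFun (w * w') = toFun w + toFun w'

section Algebra

variable {B W : Type*} [Group W] {M : CoxeterMatrix B} {cs : CoxeterSystem M W}

instance : CoeFun (WeightFunction cs) (fun _ => W → ℕ) := ⟨WeightFunction.toFun⟩

variable (L : WeightFunction cs)

theorem WeightFunction.map_one : L 1 = 0 := by
  have := L.map_mul 1 1 (by simp)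
  simp only [mul_one] at this
  omega

theorem WeightFunction.simple_mul {w : W} {i : B}
    (h : cs.length w < cs.length (cs.simple i * w)) :
    L (cs.simple i * w) = L (cs.simple i) + L w := by
  apply L.map_mul
  rw [cs.length_simple]
  have := cs.length_simple_mul w i
  omega

theorem WeightFunction.mul_simple {w : W} {i : B}
    (h : cs.length w < cs.length (w * cs.simple i)) :
    L (w * cs.simple i) = L w + L (cs.simple i) := by
  apply L.map_mul
  rw [cs.length_simple]
  have := cs.length_mul_simple w i
  omega

theorem WeightFunction.eq_of_simple_mul_eq {w : W} {i j : B}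
    (h : cs.simple i * w = w * cs.simple j) : L (cs.simple i) = L (cs.simple j) := by
  rcases lt_or_gt_of_ne (cs.length_simple_mul_ne w i) with h1 | h1
  · have e1 := L.simple_mul (w := cs.simple i * w) (i := i) (by simpa using h1)
    have e2 := L.mul_simple (w := w * cs.simple j) (i := j) (by simpa using h ▸ h1)
    simp only [CoxeterSystem.simple_mul_simple_cancel_left,
      CoxeterSystem.simple_mul_simple_cancel_right] at e1 e2
    rw [h] at e1
    omega
  · have e1 := L.simple_mul h1
    have e2 := L.mul_simple (w := w) (i := j) (by rw [← h]; exact h1)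
    rw [h] at e1
    omega

open Classical in
/-- Left multiplication by `T_s` on the free `A`-module with basis `W`. -/
def leftOp (i : B) : Module.End A (W →₀ A) :=
  Finsupp.linearCombination A fun w =>
    if cs.length w < cs.length (cs.simple i * w) then Finsupp.single (cs.simple i * w) 1
    else v (2 * L (cs.simple i)) • Finsupp.single (cs.simple i * w) 1 +
      (v (2 * L (cs.simple i)) - 1) • Finsupp.single w 1

open Classical in
/-- Right multiplication by `T_s` on the free `A`-module with basis `W`. -/
def rightOp (i : B) : Module.End A (W →₀ A) :=
  Finsupp.linearCombination A fun w =>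
    if cs.length w < cs.length (w * cs.simple i) then Finsupp.single (w * cs.simple i) 1
    else v (2 * L (cs.simple i)) • Finsupp.single (w * cs.simple i) 1 +
      (v (2 * L (cs.simple i)) - 1) • Finsupp.single w 1

open Classical in
theorem leftOp_single (i : B) (w : W) : leftOp L i (Finsupp.single w 1) =
    if cs.length w < cs.length (cs.simple i * w) then Finsupp.single (cs.simple i * w) 1
    else v (2 * L (cs.simple i)) • Finsupp.single (cs.simple i * w) 1 +
      (v (2 * L (cs.simple i)) - 1) • Finsupp.single w 1 := by
  rw [leftOp, Finsupp.linearCombination_single, one_smul]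

open Classical in
theorem rightOp_single (i : B) (w : W) : rightOp L i (Finsupp.single w 1) =
    if cs.length w < cs.length (w * cs.simple i) then Finsupp.single (w * cs.simple i) 1
    else v (2 * L (cs.simple i)) • Finsupp.single (w * cs.simple i) 1 +
      (v (2 * L (cs.simple i)) - 1) • Finsupp.single w 1 := by
  rw [rightOp, Finsupp.linearCombination_single, one_smul]

theorem rightOp_single_eq_leftOp_single {w : W} {i j : B}
    (h : cs.simple i * w = w * cs.simple j) :
    rightOp L j (Finsupp.single w 1) = leftOp L i (Finsupp.single w 1) := by
  rw [rightOp_single, leftOp_single, ← h, L.eq_of_simple_mul_eq h]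

theorem leftOp_rightOp_comm (i j : B) : leftOp L i * rightOp L j = rightOp L j * leftOp L i := by
  classical
  refine Finsupp.lhom_ext' fun w => LinearMap.ext_ring ?_
  show leftOp L i (rightOp L j (Finsupp.single w 1)) =
    rightOp L j (leftOp L i (Finsupp.single w 1))
  by_cases heq : cs.simple i * w = w * cs.simple j
  · have heq' : cs.simple i * (cs.simple i * w) = cs.simple i * w * cs.simple j := by
      rw [heq, ← mul_assoc, heq]
    have e1 := rightOp_single_eq_leftOp_single L heq
    have e2 := rightOp_single_eq_leftOp_single L heq'
    rw [e1]
    rw [leftOp_single]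
    split_ifs
    · rw [e2]
    · simp only [map_add, map_smul, e1, e2]
  · have key : ¬ (cs.length (cs.simple i * w) = cs.length (w * cs.simple j) ∧
        cs.length (cs.simple i * w * cs.simple j) = cs.length w) :=
      fun h => heq (simple_mul_eq_mul_simple cs h.1 h.2)
    have a1 := cs.length_simple_mul w i
    have a2 := cs.length_mul_simple w j
    have a3 := cs.length_simple_mul (w * cs.simple j) i
    have a4 := cs.length_mul_simple (cs.simple i * w) j
    have assoc : cs.simple i * (w * cs.simple j) = cs.simple i * w * cs.simple j :=
      (mul_assoc _ _ _).symm
    rw [assoc] at a3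
    have c1 : (cs.length (w * cs.simple j) < cs.length (cs.simple i * w * cs.simple j)) ↔
        cs.length w < cs.length (cs.simple i * w) := by omega
    have c2 : (cs.length (cs.simple i * w) < cs.length (cs.simple i * w * cs.simple j)) ↔
        cs.length w < cs.length (w * cs.simple j) := by omega
    by_cases b1 : cs.length w < cs.length (cs.simple i * w) <;>
    by_cases b2 : cs.length w < cs.length (w * cs.simple j) <;>
    · simp only [leftOp_single, rightOp_single, map_add, map_smul, assoc, c1, c2, b1, b2, if_true,
        if_false]
      try module

/-- The generic Iwahori–Hecke algebra of `W, L` over `A`: the algebra generated by the left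
multiplication operators `T_s`. -/
def H : Type _ := Algebra.adjoin A (Set.range (leftOp L))

instance : Semiring (H L) :=
  inferInstanceAs (Semiring (Algebra.adjoin A (Set.range (leftOp L))))

instance instAlgebra : Algebra A (H L) :=
  inferInstanceAs (Algebra A (Algebra.adjoin A (Set.range (leftOp L))))

instance instRing : Ring (H L) := Algebra.semiringToRing A

/-- The generator `T_s`. -/
def gen (i : B) : H L := ⟨leftOp L i, Algebra.subset_adjoin ⟨i, rfl⟩⟩

/-- Evaluation of an operator at the basis vector of the identity of `W`. -/
def ev : H L →ₗ[A] (W →₀ A) where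
  toFun f := f.1 (Finsupp.single 1 1)
  map_add' _ _ := rfl
  map_smul' _ _ := rfl

theorem commute_rightOp (f : H L) (j : B) : f.1 * rightOp L j = rightOp L j * f.1 := by
  obtain ⟨f, hf⟩ := f
  have : f ∈ Subalgebra.centralizer A {rightOp L j} := by
    refine (Algebra.adjoin_le ?_ : Algebra.adjoin A (Set.range (leftOp L)) ≤ _) hf
    rintro _ ⟨i, rfl⟩
    intro g hg
    rw [Set.mem_singleton_iff.1 hg]
    exact (leftOp_rightOp_comm L i j).symm
  exact (this _ rfl).symm

theorem ev_injective : Function.Injective (ev L) := by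
  rw [injective_iff_map_eq_zero]
  intro f hf
  have hf' : f.1 (Finsupp.single 1 1) = 0 := hf
  have key : ∀ n : ℕ, ∀ w : W, cs.length w = n → f.1 (Finsupp.single w 1) = 0 := by
    intro n
    induction n with
    | zero =>
      intro w hw
      rw [cs.length_eq_zero_iff.1 hw]; exact hf'
    | succ n ih =>
      intro w hw
      have hne : w ≠ 1 := by rintro rfl; simp at hw
      obtain ⟨i, hi⟩ := cs.exists_rightDescent_of_ne_one hne
      have hi' : cs.length (w * cs.simple i) < cs.length w := hi
      have h1 := cs.length_mul_simple w i
      have h2 : rightOp L i (Finsupp.single (w * cs.simple i) 1) = Finsupp.single w 1 := by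
        rw [rightOp_single, if_pos (by simpa using hi')]; simp
      have h3 := LinearMap.congr_fun (commute_rightOp L f i) (Finsupp.single (w * cs.simple i) 1)
      simp only [Module.End.mul_apply, h2] at h3
      rw [h3, ih _ (by omega), map_zero]
  apply Subtype.ext
  refine Finsupp.lhom_ext' fun w => LinearMap.ext_ring ?_
  exact (show f.1 (Finsupp.single w 1) = 0 from key _ w rfl).trans rfl

theorem ev_gen_mul (i : B) (f : H L) : ev L (gen L i * f) = leftOp L i (ev L f) := rfl

theorem ev_surjective : Function.Surjective (ev L) := by
  have key : ∀ n : ℕ, ∀ w : W, cs.length w = n → Finsupp.single w 1 ∈ LinearMap.range (ev L) := by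
    intro n
    induction n with
    | zero =>
      intro w hw
      rw [cs.length_eq_zero_iff.1 hw]
      exact ⟨1, rfl⟩
    | succ n ih =>
      intro w hw
      have hne : w ≠ 1 := by rintro rfl; simp at hw
      obtain ⟨i, hi⟩ := cs.exists_leftDescent_of_ne_one hne
      have hi' : cs.length (cs.simple i * w) < cs.length w := hi
      have h1 := cs.length_simple_mul w i
      obtain ⟨f, hf⟩ := ih (cs.simple i * w) (by omega)
      refine ⟨gen L i * f, ?_⟩
      rw [ev_gen_mul, hf, leftOp_single, if_pos (by simpa using hi')]; simp
  rw [← LinearMap.range_eq_top, eq_top_iff, ← (Finsupp.basisSingleOne (R := A)).span_eq,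
    Submodule.span_le]
  rintro _ ⟨w, rfl⟩
  simpa using key _ w rfl

/-- The standard basis `{T_w}` of the generic Iwahori–Hecke algebra. -/
def T : Module.Basis W A (H L) :=
  ⟨LinearEquiv.ofBijective (ev L) ⟨ev_injective L, ev_surjective L⟩⟩

theorem ev_T (w : W) : ev L (T L w) = Finsupp.single w 1 :=
  (T L).repr_self w

theorem T_one : T L 1 = 1 := ev_injective L (ev_T L 1)

theorem T_simple (i : B) : T L (cs.simple i) = gen L i := by
  apply ev_injective L
  rw [ev_T, ← mul_one (gen L i), ev_gen_mul, ← T_one, ev_T, leftOp_single, if_pos (by simp)]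
  simp

open Classical in
/-- The multiplication rule which characterises the generic Iwahori–Hecke algebra. -/
theorem T_simple_mul (i : B) (w : W) : T L (cs.simple i) * T L w =
    if cs.length w < cs.length (cs.simple i * w) then T L (cs.simple i * w)
    else v (2 * L (cs.simple i)) • T L (cs.simple i * w) +
      (v (2 * L (cs.simple i)) - 1) • T L w := by
  apply ev_injective L
  rw [T_simple, ev_gen_mul, ev_T, leftOp_single]
  split_ifs <;> simp [ev_T]

/-- The rescaled basis `T̃_w = v^{-L(w)} T_w`. -/
def tT : Module.Basis W A (H L) :=
  (T L).isUnitSMul (w := fun w => v (-(L w : ℤ))) fun _ => LaurentPolynomial.isUnit_T _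

theorem tT_apply (w : W) : tT L w = v (-(L w : ℤ)) • T L w := by
  rw [tT, Module.Basis.isUnitSMul_apply]

theorem tT_one : tT L 1 = 1 := by
  rw [tT_apply, T_one, L.map_one]; simp

theorem tT_simple_mul_of_lt {i : B} {w : W} (h : cs.length w < cs.length (cs.simple i * w)) :
    tT L (cs.simple i) * tT L w = tT L (cs.simple i * w) := by
  simp only [tT_apply, smul_mul_smul_comm, T_simple_mul, if_pos h, L.simple_mul h]
  rw [← LaurentPolynomial.T_add]
  congr 2
  push_cast; ring

theorem tT_simple_sq (i : B) : tT L (cs.simple i) * tT L (cs.simple i) =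
    1 + (v (L (cs.simple i)) - v (-(L (cs.simple i) : ℤ))) • tT L (cs.simple i) := by
  have h : ¬ cs.length (cs.simple i) < cs.length 1 := by simp
  simp only [tT_apply, smul_mul_smul_comm, T_simple_mul, cs.simple_mul_simple_self, if_neg h,
    T_one, smul_add, smul_smul]
  congr 1
  · rw [← LaurentPolynomial.T_add, ← LaurentPolynomial.T_add]
    rw [show -(L (cs.simple i) : ℤ) + -(L (cs.simple i)) + 2 * (L (cs.simple i)) = 0 by ring]
    simp
  · congr 1
    simp only [mul_sub, sub_mul, ← LaurentPolynomial.T_add, mul_one]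
    congr 2; ring

/-- `ξ_s = v^{L(s)} - v^{-L(s)}`. -/
abbrev xi (i : B) : A := v (L (cs.simple i)) - v (-(L (cs.simple i) : ℤ))

theorem tT_simple_mul_of_gt {i : B} {w : W} (h : cs.length (cs.simple i * w) < cs.length w) :
    tT L (cs.simple i) * tT L w = tT L (cs.simple i * w) + xi L i • tT L w := by
  have e := tT_simple_mul_of_lt L (i := i) (w := cs.simple i * w) (by simpa using h)
  rw [CoxeterSystem.simple_mul_simple_cancel_left] at e
  rw [← e, ← mul_assoc, tT_simple_sq, add_mul, one_mul, smul_mul_assoc]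

/-- The inverse `T̃_s⁻¹ = T̃_s - ξ_s`. -/
def tTinv (i : B) : H L := tT L (cs.simple i) - xi L i • 1

theorem tT_mul_inv (i : B) : tT L (cs.simple i) * tTinv L i = 1 := by
  rw [tTinv, mul_sub, tT_simple_sq, mul_smul_comm, mul_one]; simp

theorem tTinv_mul (i : B) : tTinv L i * tT L (cs.simple i) = 1 := by
  rw [tTinv, sub_mul, tT_simple_sq, smul_mul_assoc, one_mul]; simp

theorem tT_mul_simple_of_lt {i : B} {w : W} (h : cs.length w < cs.length (w * cs.simple i)) :
    tT L w * tT L (cs.simple i) = tT L (w * cs.simple i) := by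
  have key : ∀ n : ℕ, ∀ w : W, cs.length w = n → cs.length w < cs.length (w * cs.simple i) →
      tT L w * tT L (cs.simple i) = tT L (w * cs.simple i) := by
    intro n
    induction n with
    | zero =>
      intro w hw _
      rw [cs.length_eq_zero_iff.1 hw, tT_one]; simp
    | succ n ih =>
      intro w hw h
      have hne : w ≠ 1 := by rintro rfl; simp at hw
      obtain ⟨j, hj⟩ := cs.exists_leftDescent_of_ne_one hne
      have hj' : cs.length (cs.simple j * w) < cs.length w := hj
      have h1 := cs.length_simple_mul w j
      have h2 := cs.length_mul_simple w i
      have h3 := cs.length_mul_simple (cs.simple j * w) i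
      have h4 := cs.length_simple_mul (w * cs.simple i) j
      rw [← mul_assoc] at h4
      have e := tT_simple_mul_of_lt L (i := j) (w := cs.simple j * w) (by simpa using hj')
      rw [CoxeterSystem.simple_mul_simple_cancel_left] at e
      rw [← e, mul_assoc, ih _ (by omega) (by omega), tT_simple_mul_of_lt L]
      · simp [mul_assoc]
      · rw [mul_assoc, CoxeterSystem.simple_mul_simple_cancel_left, ← mul_assoc]
        omega
  exact key _ w rfl h

theorem isUnit_tT (w : W) : IsUnit (tT L w) := by
  have key : ∀ n : ℕ, ∀ w : W, cs.length w = n → IsUnit (tT L w) := by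
    intro n
    induction n with
    | zero =>
      intro w hw
      rw [cs.length_eq_zero_iff.1 hw, tT_one]; exact isUnit_one
    | succ n ih =>
      intro w hw
      have hne : w ≠ 1 := by rintro rfl; simp at hw
      obtain ⟨j, hj⟩ := cs.exists_leftDescent_of_ne_one hne
      have hj' : cs.length (cs.simple j * w) < cs.length w := hj
      have h1 := cs.length_simple_mul w j
      have e := tT_simple_mul_of_lt L (i := j) (w := cs.simple j * w) (by simpa using hj')
      rw [CoxeterSystem.simple_mul_simple_cancel_left] at e
      rw [← e]
      exact (IsUnit.mul ⟨⟨_, _, tT_mul_inv L j, tTinv_mul L j⟩, rfl⟩ (ih _ (by omega)))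
  exact key _ w rfl

/-- The element `T̃_{w⁻¹}⁻¹`. -/
def tTbar (w : W) : H L := Ring.inverse (tT L w⁻¹)

theorem tTbar_one : tTbar L 1 = 1 := by
  rw [tTbar, inv_one, tT_one, Ring.inverse_one]

theorem tTbar_mul_tT (w : W) : tTbar L w * tT L w⁻¹ = 1 :=
  Ring.inverse_mul_cancel _ (isUnit_tT L _)

theorem tTbar_simple (i : B) : tTbar L (cs.simple i) = tTinv L i := by
  have h := tTbar_mul_tT L (cs.simple i)
  rw [cs.inv_simple] at h
  calc tTbar L (cs.simple i)
      = tTbar L (cs.simple i) * (tT L (cs.simple i) * tTinv L i) := by rw [tT_mul_inv, mul_one]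
    _ = tTinv L i := by rw [← mul_assoc, h, one_mul]

theorem tTbar_simple_mul_of_lt {i : B} {w : W} (h : cs.length w < cs.length (cs.simple i * w)) :
    tTbar L (cs.simple i * w) = tTinv L i * tTbar L w := by
  have h' : cs.length w⁻¹ < cs.length (w⁻¹ * cs.simple i) := by
    have := cs.length_inv (cs.simple i * w)
    rw [mul_inv_rev, cs.inv_simple] at this
    rw [this, cs.length_inv]; exact h
  have e : tT L (cs.simple i * w)⁻¹ = tT L w⁻¹ * tT L (cs.simple i) := by
    rw [tT_mul_simple_of_lt L h', mul_inv_rev, cs.inv_simple]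
  have e2 : tT L w⁻¹ * tTbar L w = 1 := Ring.mul_inverse_cancel _ (isUnit_tT L _)
  calc tTbar L (cs.simple i * w)
      = tTbar L (cs.simple i * w) * (tT L (cs.simple i * w)⁻¹ * (tTinv L i * tTbar L w)) := by
        rw [e, mul_assoc (tT L w⁻¹), ← mul_assoc (tT L (cs.simple i)), tT_mul_inv, one_mul, e2,
          mul_one]
    _ = tTinv L i * tTbar L w := by rw [← mul_assoc, tTbar_mul_tT, one_mul]

/-- The `A`-linear map `h ↦ h†` with `T̃_w† = (-1)^{l(w)} T̃_{w⁻¹}⁻¹`. -/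
def dagger : H L →ₗ[A] H L :=
  (tT L).constr A fun w => (-1 : A) ^ cs.length w • tTbar L w

theorem dagger_tT (w : W) : dagger L (tT L w) = (-1 : A) ^ cs.length w • tTbar L w :=
  (tT L).constr_basis A _ w

theorem dagger_simple (i : B) : dagger L (tT L (cs.simple i)) = -tTinv L i := by
  rw [dagger_tT, cs.length_simple, tTbar_simple]; simp

theorem dagger_simple_mul (i : B) (h : H L) :
    dagger L (tT L (cs.simple i) * h) = -tTinv L i * dagger L h := by
  have : (dagger L) ∘ₗ (LinearMap.mulLeft A (tT L (cs.simple i))) =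
      (LinearMap.mulLeft A (-tTinv L i)) ∘ₗ (dagger L) := by
    refine (tT L).ext fun w => ?_
    simp only [LinearMap.comp_apply, LinearMap.mulLeft_apply]
    rcases lt_or_gt_of_ne (cs.length_simple_mul_ne w i) with hlt | hlt
    · have e := tTbar_simple_mul_of_lt L (i := i) (w := cs.simple i * w) (by simpa using hlt)
      rw [CoxeterSystem.simple_mul_simple_cancel_left] at e
      have hl : cs.length w = cs.length (cs.simple i * w) + 1 := by
        have := cs.length_simple_mul w i
        omega
      rw [tT_simple_mul_of_gt L hlt, map_add, map_smul, dagger_tT, dagger_tT, e, hl, pow_succ]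
      have e2 : tTbar L (cs.simple i * w) =
          tT L (cs.simple i) * (tTinv L i * tTbar L (cs.simple i * w)) := by
        rw [← mul_assoc, tT_mul_inv, one_mul]
      have e3 : tT L (cs.simple i) = tTinv L i + xi L i • 1 := by rw [tTinv]; abel
      set x := tTinv L i * tTbar L (cs.simple i * w) with hx
      rw [e2, e3, add_mul, smul_mul_assoc, one_mul, mul_smul_comm, neg_mul]
      module
    · have hl : cs.length (cs.simple i * w) = cs.length w + 1 := by
        have := cs.length_simple_mul w i
        omega
      rw [tT_simple_mul_of_lt L hlt, dagger_tT, dagger_tT, tTbar_simple_mul_of_lt L hlt, hl,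
        pow_succ, mul_smul_comm, neg_mul]
      module
  exact LinearMap.congr_fun this h

/-- `†` is an involution. -/
theorem dagger_dagger (h : H L) : dagger L (dagger L h) = h := by
  have key : ∀ n : ℕ, ∀ w : W, cs.length w = n → dagger L (dagger L (tT L w)) = tT L w := by
    intro n
    induction n with
    | zero =>
      intro w hw
      have h1 : dagger L (tT L 1) = tT L 1 := by
        rw [dagger_tT, tTbar_one, tT_one]; simp
      rw [cs.length_eq_zero_iff.1 hw, h1, h1]
    | succ n ih =>
      intro w hw
      have hne : w ≠ 1 := by rintro rfl; simp at hw
      obtain ⟨j, hj⟩ := cs.exists_leftDescent_of_ne_one hne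
      have hj' : cs.length (cs.simple j * w) < cs.length w := hj
      have h1 := cs.length_simple_mul w j
      have e := tT_simple_mul_of_lt L (i := j) (w := cs.simple j * w) (by simpa using hj')
      rw [CoxeterSystem.simple_mul_simple_cancel_left] at e
      rw [← e, dagger_simple_mul]
      have e4 : ∀ x : H L, dagger L (-tTinv L j * x) = tT L (cs.simple j) * dagger L x := by
        intro x
        rw [tTinv, neg_mul, sub_mul, smul_mul_assoc, one_mul, map_neg, map_sub, map_smul,
          dagger_simple_mul, tTinv, neg_mul, sub_mul, smul_mul_assoc, one_mul]
        abel
      rw [e4, ih _ (by omega)]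
  have : (dagger L) ∘ₗ (dagger L) = LinearMap.id := (tT L).ext fun w => key _ w rfl
  exact LinearMap.congr_fun this h

/-- `†` as a linear automorphism. -/
def daggerEquiv : H L ≃ₗ[A] H L := LinearEquiv.ofInvolutive (dagger L) (dagger_dagger L)

/-! ### The Kazhdan–Lusztig basis, the function `a`, and the coefficients `γ` -/

/-- The ring involution `∑ a_w T̃_w ↦ ∑ ā_w T̃_{w⁻¹}⁻¹` of `H`, where `ā(v) = a(v⁻¹)`. -/
def bar (h : H L) : H L :=
  ((tT L).repr h).sum fun w a => LaurentPolynomial.invert a • tTbar L w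

/-- `b` is the Kazhdan–Lusztig basis: each `b w` is fixed by the bar involution and is congruent to
`T̃_w` modulo the `v⁻¹ℤ[v⁻¹]`-combinations of the elements `T̃_y`. -/
def IsKLBasis (b : Module.Basis W A (H L)) : Prop :=
  ∀ w, bar L (b w) = b w ∧
    ∀ y : W, ∀ i : ℤ, 0 ≤ i → ((tT L).repr (b w - tT L w) y).coeff i = 0

instance : Nonempty (Module.Basis W A (H L)) := ⟨T L⟩

/-- The Kazhdan–Lusztig basis `{c_w}` of `H`, which exists and is unique by the theorem of
Kazhdan and Lusztig. -/
def c : Module.Basis W A (H L) := Classical.epsilon (IsKLBasis L)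

/-- The structure constants: `c_x c_y = ∑_z h_{x,y,z} c_z`. -/
def hCoeff (x y z : W) : A := (c L).repr (c L x * c L y) z

/-- The function `a`: the least `i ≥ 0` such that `v^i h_{x,y,z} ∈ ℤ[v]` for all `x, y`. -/
def aFun (z : W) : ℕ :=
  sInf {i : ℕ | ∀ x y : W, v i * hCoeff L x y z ∈
    Set.range (Polynomial.toLaurent : Polynomial ℤ → A)}

/-- `γ_{x,y,z}` is the constant term of `v^{a(z)} h_{x,y,z⁻¹}`. -/
def gam (x y z : W) : ℤ := (v (aFun L z) * hCoeff L x y z⁻¹).coeff 0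

/-- The trace form: `τ(T_1) = 1` and `τ(T_w) = 0` for `w ≠ 1`. -/
def tau (h : H L) : A := (T L).repr h 1

/-- `-Δ(z)` is the degree of `τ(c_z)`, with `Δ(z) = ∞` if `τ(c_z) = 0`. -/
def Delta (z : W) : WithTop ℤ :=
  WithBot.recBotCoe (C := fun _ => WithTop ℤ) ⊤ (fun d : ℤ => ((-d : ℤ) : WithTop ℤ))
    (tau L (c L z)).degree

/-- `n_z` is the leading coefficient of `τ(c_z)`, i.e. the coefficient of `v^{-Δ(z)}`. -/
def nCoeff (z : W) : ℤ :=
  (tau L (c L z)).coeff ((tau L (c L z)).degree.unbotD 0)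

/-- `𝒟 = {z ∈ W | a(z) = Δ(z)}`. -/
def DSet : Set W := {z | (((aFun L z : ℕ) : ℤ) : WithTop ℤ) = Delta L z}

/-- `n̂_z = n_d`, where `d` is the unique element of `𝒟` with `γ_{z,z⁻¹,d} ≠ 0`. -/
def nHat (z : W) : ℤ :=
  nCoeff L (Classical.epsilon fun d => d ∈ DSet L ∧ gam L z z⁻¹ d ≠ 0)

/-- Lusztig's properties P2–P8 and P15'. -/
structure LusztigProperties [Fintype W] : Prop where
  P2 : ∀ d ∈ DSet L, ∀ x y : W, gam L x y d ≠ 0 → x = y⁻¹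
  P3 : ∀ y : W, ∃! d, d ∈ DSet L ∧ gam L y⁻¹ y d ≠ 0
  P4 : ∀ x y z : W, hCoeff L x y z ≠ 0 → aFun L x ≤ aFun L z ∧ aFun L y ≤ aFun L z
  P5 : ∀ d ∈ DSet L, ∀ y : W, gam L y⁻¹ y d ≠ 0 →
    gam L y⁻¹ y d = nCoeff L d ∧ (nCoeff L d = 1 ∨ nCoeff L d = -1)
  P6 : ∀ d ∈ DSet L, d ^ 2 = 1
  P7 : ∀ x y z : W, gam L x y z = gam L y z x
  P8 : ∀ x y z : W, gam L x y z ≠ 0 → aFun L x = aFun L y ∧ aFun L y = aFun L z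
  P15' : ∀ x x' y w : W, aFun L w = aFun L y →
    ∑ u : W, (gam L w x' u⁻¹ : A) * hCoeff L x u y =
      ∑ u : W, (gam L u x' y⁻¹ : A) * hCoeff L x w u

/-- The `A`-basis `{c_w†}` of `H`. -/
def cDagger : Module.Basis W A (H L) := (c L).map (daggerEquiv L)

theorem cDagger_apply (w : W) : cDagger L w = dagger L (c L w) := rfl

end Algebra

/-! ### Specialisation to a field `k`, given as an `A`-algebra via `θ : A → k` -/

section Specialisation

variable {B W : Type*} [Group W] {M : CoxeterMatrix B} {cs : CoxeterSystem M W}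
variable (L : WeightFunction cs) (k : Type*) [Field k] [Algebra A k]

/-- The specialised algebra `H_k = k ⊗_A H`. -/
abbrev Hk : Type _ := k ⊗[A] H L

/-- The `k`-basis of `H_k` given by the (specialised) elements `c_w†`. -/
def cDaggerK : Module.Basis W k (Hk L k) := Algebra.TensorProduct.basis k (cDagger L)

/-- The free `R`-module with basis `{t_w | w ∈ W}`, underlying Lusztig's ring `J` with scalars
extended to `R`. -/
abbrev J (_ : WeightFunction cs) (R : Type*) [CommRing R] : Type _ := W →₀ R

open Classical in
/-- Lusztig's map `φ : H → J_A`,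
`φ(c_w†) = ∑ h_{w,d,z} n̂_z t_z`, the sum being over `z ∈ W`, `d ∈ 𝒟` with `a(z) = a(d)`. -/
def phi [Fintype W] : H L →ₗ[A] J L A :=
  (cDagger L).constr A fun w =>
    ∑ z : W, ∑ d : W, if d ∈ DSet L ∧ aFun L z = aFun L d then
      Finsupp.single z (hCoeff L w d z * (nHat L z : A)) else 0

/-- The specialisation `φ_k : H_k → J_k` of `φ`. -/
def phiK [Fintype W] : Hk L k →ₗ[k] J L k :=
  LinearMap.liftBaseChange k (Finsupp.mapRange.linearMap (Algebra.linearMap A k) ∘ₗ phi L)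

/-- `H_k^{≥a}`, the `k`-span of the `c_w†` with `a(w) ≥ a`. -/
def Hge (a : ℕ) : Submodule k (Hk L k) :=
  Submodule.span k (cDaggerK L k '' {w | a ≤ aFun L w})

/-- `H_k^a = H_k^{≥a} / H_k^{>a}`. -/
abbrev Hgr (a : ℕ) : Type _ := Hge L k a ⧸ (Hge L k (a + 1)).submoduleOf (Hge L k a)

/-- The class `[f] ∈ H_k^a` of an element `f ∈ H_k^{≥a}`. -/
abbrev cls (a : ℕ) (f : Hge L k a) : Hgr L k a := Submodule.Quotient.mk f

/-- The element `c_w†` of `H_k^{≥a}`, for `a(w) ≥ a`. -/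
def cDaggerGe (a : ℕ) (w : W) (hw : a ≤ aFun L w) : Hge L k a :=
  ⟨cDaggerK L k w, Submodule.subset_span ⟨w, hw, rfl⟩⟩

open Classical in
/-- The operator `c_w† ↦ ∑_z γ_{x,w,z⁻¹} n̂_w n̂_z c_z†` on `H_k`, the sum being over the `z` with
`a(z) = a(w)`. (By P8, the coefficient vanishes for all other `z`.) -/
def starOp [Fintype W] (x : W) : Hk L k →ₗ[k] Hk L k :=
  (cDaggerK L k).constr k fun w => ∑ z : W, if aFun L z = aFun L w then
    ((gam L x w z⁻¹ * nHat L w * nHat L z : ℤ) : k) • cDaggerK L k z else 0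

theorem starOp_mem [Fintype W] (x : W) (a : ℕ) (f : Hk L k) (hf : f ∈ Hge L k a) :
    starOp L k x f ∈ Hge L k a := by
  have : Hge L k a ≤ (Hge L k a).comap (starOp L k x) := by
    rw [Hge, Submodule.span_le]
    rintro _ ⟨w, hw, rfl⟩
    rw [SetLike.mem_coe, Submodule.mem_comap, starOp, Module.Basis.constr_basis]
    refine Submodule.sum_mem _ fun z _ => ?_
    split_ifs with h
    · exact Submodule.smul_mem _ _ (Submodule.subset_span ⟨z, by
        show a ≤ aFun L z
        rw [h]; exact hw, rfl⟩)
    · exact Submodule.zero_mem _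
  exact this hf

/-- The action `t_x ⋆ -` on `H_k^a`. -/
def starBasis [Fintype W] (a : ℕ) (x : W) : Hgr L k a →ₗ[k] Hgr L k a :=
  Submodule.mapQ _ _ ((starOp L k x).restrict fun f hf => starOp_mem L k x a f hf)
    (by
      intro f hf
      rw [Submodule.submoduleOf, Submodule.mem_comap] at hf ⊢
      rw [Submodule.mem_comap]
      exact starOp_mem L k x (a + 1) f.1 hf)

/-- The `k`-bilinear map `⋆ : J_k × H_k^a → H_k^a`. -/
def jStar [Fintype W] (a : ℕ) : J L k →ₗ[k] Hgr L k a →ₗ[k] Hgr L k a :=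
  Finsupp.linearCombination k (starBasis L k a)

open Classical in
/-- The defining formula `t_x ⋆ [c_w†] = ∑_z γ_{x,w,z⁻¹} n̂_w n̂_z [c_z†]` for `a(w) = a`. -/
theorem jStar_single_cls [Fintype W] (x w : W) :
    jStar L k (aFun L w) (Finsupp.single x 1) (cls L k _ (cDaggerGe L k _ w le_rfl)) =
      ∑ z : W, if h : aFun L z = aFun L w then
        ((gam L x w z⁻¹ * nHat L w * nHat L z : ℤ) : k) •
          cls L k _ (cDaggerGe L k _ z h.ge) else 0 := by
  rw [jStar, Finsupp.linearCombination_single, one_smul, starBasis]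
  have e : (starOp L k x).restrict (fun f hf => starOp_mem L k x (aFun L w) f hf)
      (cDaggerGe L k _ w le_rfl) = ∑ z : W, if h : aFun L z = aFun L w then
        ((gam L x w z⁻¹ * nHat L w * nHat L z : ℤ) : k) • (cDaggerGe L k _ z h.ge) else 0 := by
    apply Subtype.ext
    rw [LinearMap.coe_restrict_apply, cDaggerGe, starOp, Module.Basis.constr_basis,
      Submodule.coe_sum]
    refine Finset.sum_congr rfl fun z _ => ?_
    split_ifs <;> rfl
  rw [cls, Submodule.mapQ_apply, e, ← Submodule.mkQ_apply, map_sum]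
  refine Finset.sum_congr rfl fun z _ => ?_
  split_ifs <;> simp

/-! ### The modules `M̃` and the invariants `α_M` -/

variable (V : Type*) [AddCommGroup V] [Module (Hk L k) V]

/-- The invariant `α_V`: the largest value `a(w)` such that `c_w†` acts as non-zero on `V`. -/
def alpha : ℕ := sSup {n | ∃ w : W, aFun L w = n ∧ ∃ m : V, cDaggerK L k w • m ≠ 0}

/-- The relations `[f h] ⊗ m - [f] ⊗ h m` (`f ∈ H_k^{≥a}`, `h ∈ H_k`, `m ∈ V`) defining the tensor
product over `H_k`. (By P4, `f h ∈ H_k^{≥a}` for all `f ∈ H_k^{≥a}` and `h ∈ H_k`.) -/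
def tensorRel (a : ℕ) : Submodule ℤ (Hgr L k a ⊗[ℤ] V) :=
  Submodule.span ℤ {t | ∃ (f g : Hge L k a) (h : Hk L k) (m : V), (g : Hk L k) = f * h ∧
    t = cls L k a g ⊗ₜ[ℤ] m - cls L k a f ⊗ₜ[ℤ] (h • m)}

/-- The tensor product `H_k^a ⊗_{H_k} V`. -/
abbrev HgrTensor (a : ℕ) : Type _ := (Hgr L k a ⊗[ℤ] V) ⧸ tensorRel L k V a

/-- `Ṽ = H_k^a ⊗_{H_k} V` where `a = α_V`. -/
abbrev Tilde : Type _ := HgrTensor L k V (alpha L k V)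

/-- The element `x ⊗ m` of `Ṽ`. -/
def tildeMk (x : Hgr L k (alpha L k V)) (m : V) : Tilde L k V :=
  Submodule.Quotient.mk (x ⊗ₜ[ℤ] m)

end Specialisation

/-! ### Composition factors -/

section CompositionFactors

variable (R : Type*) [Ring R] (X : Type*) [AddCommGroup X] [Module R X]
variable (S : Type*) [AddCommGroup S] [Module R S]

/-- `S` is a composition factor of `X`: `S` is simple and isomorphic to a subquotient of `X`. -/
def IsCompositionFactor : Prop :=
  IsSimpleModule R S ∧ ∃ N₁ N₂ : Submodule R X, N₁ ≤ N₂ ∧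
    Nonempty ((N₂ ⧸ N₁.submoduleOf N₂) ≃ₗ[R] S)

/-- `X` has a composition series, and in every composition series of `X` there are
exactly `n` factors isomorphic to `S`. -/
def HasMultiplicity (n : ℕ) : Prop :=
  (∃ s : CompositionSeries (Submodule R X), s.head = ⊥ ∧ s.last = ⊤) ∧
  ∀ s : CompositionSeries (Submodule R X), s.head = ⊥ → s.last = ⊤ →
    Nat.card {i : Fin s.length //
      Nonempty ((s i.succ ⧸ (s i.castSucc).submoduleOf (s i.succ)) ≃ₗ[R] S)} = n

end CompositionFactors

end IwahoriHecke

end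

/-! Write `a` for `alpha L k V`. The heart of the matter is that, modulo `Hge (a + 1)`, acting
through `φ` and `⋆` is the same as left multiplication: `φ(h) ⋆ [f] = [h f]` (`jStar_phiK_cls`). On
the basis this compares coefficients of `c_y†` with `a(y) = a(w)` (`sum_hCoeff_mul_gam`), where P15'
collapses the double sum defining `φ(c_x†) ⋆ c_w†` to `h_{x,w,y}`. By P4 the terms of `c_x† c_w†`
left over have a larger `a`-value.

Hence the twisted module is `H_k^a ⊗ V` with left multiplication. The evaluation `π([f] ⊗ m) = f m`
is well defined because `Hge (a + 1)` kills `V`, it is `H_k`-linear, and it is surjective because it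
is nonzero and `V` is simple.

For `f` in `Hge a` and `x = ∑ [g_i] ⊗ m_i`, moving `g_i` across the tensor sign gives `f x = ∑ [f
g_i] ⊗ m_i = [f] ⊗ π(x)` (`tensorAct_eq_tensorMk_evalTensor`). So the ideal `Hge a` annihilates `ker
π`, and every composition factor of `ker π` has smaller invariant. Some `c_w†` in `Hge a` does not
kill `V`, so in a composition series `V` appears exactly at the step that leaves `ker π`
(`hasMultiplicity_one`). A composition series exists because `H_k` is Artinian and the module is
finitely generated. -/

noncomputable section

open scoped TensorProduct

namespace IwahoriHecke

/-! ### Multiplicity one from an element that separates the kernel from the quotient -/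

section Multiplicity

variable {R X S : Type*} [Ring R] [AddCommGroup X] [Module R X] [AddCommGroup S] [Module R S]

theorem smul_eq_zero_of_subquotient {N₁ N₂ : Submodule R X}
    (e : (N₂ ⧸ N₁.submoduleOf N₂) ≃ₗ[R] S) {h : R} (hh : ∀ x ∈ N₂, h • x ∈ N₁) (m : S) :
    h • m = 0 := by
  obtain ⟨q, rfl⟩ := e.surjective m
  obtain ⟨x, rfl⟩ := Submodule.Quotient.mk_surjective _ q
  have hx : h • x ∈ N₁.submoduleOf N₂ := hh x.1 x.2
  rw [← map_smul, ← Submodule.Quotient.mk_smul, (Submodule.Quotient.mk_eq_zero _).2 hx, map_zero]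

theorem exists_mem_map_eq [IsSimpleModule R S] (π : X →ₗ[R] S) {N : Submodule R X}
    (hN : ¬ N ≤ LinearMap.ker π) (m : S) : ∃ x ∈ N, π x = m := by
  have : N.map π = ⊤ := by
    refine (eq_bot_or_eq_top _).resolve_left fun hb => hN fun x hx => ?_
    have := Submodule.mem_map_of_mem (f := π) hx
    rwa [hb, Submodule.mem_bot] at this
  exact Submodule.mem_map.1 (this ▸ Submodule.mem_top : m ∈ N.map π)

/-- If some `h : R` kills `ker π` but not the simple module `S`, then a simple subquotient
`N₂ / N₁` is isomorphic to `S` exactly when `N₁ ≤ ker π` and `N₂ ≰ ker π`. -/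
theorem nonempty_subquotient_equiv_iff [IsSimpleModule R S] (π : X →ₗ[R] S) {h : R}
    (hker : ∀ x ∈ LinearMap.ker π, h • x = 0) (hS : ∃ m : S, h • m ≠ 0)
    {N₁ N₂ : Submodule R X} (hN : N₁ ⋖ N₂) :
    Nonempty ((N₂ ⧸ N₁.submoduleOf N₂) ≃ₗ[R] S) ↔
      N₁ ≤ LinearMap.ker π ∧ ¬ N₂ ≤ LinearMap.ker π := by
  constructor
  · rintro ⟨e⟩
    obtain ⟨m, hm⟩ := hS
    constructor
    · by_contra h1
      refine hm (smul_eq_zero_of_subquotient e (fun x _ => ?_) m)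
      -- `N₁` already surjects onto `S`, so `x` differs from some `y ∈ N₁` by an element of `ker π`,
      -- which `h` kills. Thus `h • x = h • y ∈ N₁`, and `h` would act as zero on `S`.
      obtain ⟨y, hy, hxy⟩ := exists_mem_map_eq π h1 (π x)
      have := hker (x - y) (by rw [LinearMap.mem_ker, map_sub, hxy, sub_self])
      rw [smul_sub, sub_eq_zero] at this
      exact this ▸ N₁.smul_mem h hy
    · intro h2
      exact hm (smul_eq_zero_of_subquotient e (fun x hx => hker x (h2 hx) ▸ N₁.zero_mem) m)
  · rintro ⟨h1, h2⟩
    have hsurj : Function.Surjective (π.domRestrict N₂) := fun m => by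
      obtain ⟨x, hx, rfl⟩ := exists_mem_map_eq π h2 m
      exact ⟨⟨x, hx⟩, rfl⟩
    -- The kernel of `π` on `N₂` lies between `N₁` and `N₂` and is not `N₂`, so the covering
    -- relation forces it to be `N₁`.
    have hinf : N₂ ⊓ LinearMap.ker π = N₁ :=
      (hN.eq_or_eq (le_inf hN.le h1) inf_le_left).resolve_right fun h => h2 (inf_eq_left.1 h)
    have hk : N₁.submoduleOf N₂ = LinearMap.ker (π.domRestrict N₂) := by
      ext x
      rw [← hinf]
      simp [Submodule.submoduleOf]
    exact ⟨(Submodule.quotEquivOfEq _ _ hk).trans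
      ((π.domRestrict N₂).quotKerEquivOfSurjective hsurj)⟩

/-- A chain from `⊥` to `⊤` leaves `ker π` at exactly one step, and by
`nonempty_subquotient_equiv_iff` that is the only step whose factor is isomorphic to `S`. -/
theorem hasMultiplicity_one [IsNoetherian R X] [IsArtinian R X] [IsSimpleModule R S]
    (π : X →ₗ[R] S) (hπ : Function.Surjective π) {h : R}
    (hker : ∀ x ∈ LinearMap.ker π, h • x = 0) (hS : ∃ m : S, h • m ≠ 0) :
    HasMultiplicity R X S 1 := by
  refine ⟨exists_compositionSeries_of_isNoetherian_isArtinian R X, fun s hs0 hs1 => ?_⟩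
  have hcov (i : Fin s.length) : s i.castSucc ⋖ s i.succ := s.step i
  have hmono : Monotone s := s.strictMono.monotone
  have hex : ∃ i : Fin s.length,
      s i.castSucc ≤ LinearMap.ker π ∧ ¬ s i.succ ≤ LinearMap.ker π := by
    by_contra! hno
    have hall (i : Fin (s.length + 1)) : s i ≤ LinearMap.ker π := by
      induction i using Fin.induction with
      | zero => exact (show s 0 = ⊥ from hs0) ▸ bot_le
      | succ i ih => exact hno i ih
    obtain ⟨m, hm⟩ := hS
    obtain ⟨x, rfl⟩ := hπ m
    have hx : x ∈ s (Fin.last _) := (show s (Fin.last _) = ⊤ from hs1) ▸ Submodule.mem_top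
    exact hm (by rw [LinearMap.mem_ker.1 (hall _ hx), smul_zero])
  obtain ⟨i, hi⟩ := hex
  rw [Nat.card_eq_one_iff_unique]
  refine ⟨⟨?_⟩, ⟨⟨i, (nonempty_subquotient_equiv_iff π hker hS (hcov i)).2 hi⟩⟩⟩
  -- Once the chain has left `ker π` it cannot return: for `j < l`, `s j.succ ≤ s l.castSucc`.
  have key : ∀ j l : Fin s.length, s j.castSucc ≤ LinearMap.ker π ∧
      ¬ s j.succ ≤ LinearMap.ker π → s l.castSucc ≤ LinearMap.ker π ∧
      ¬ s l.succ ≤ LinearMap.ker π → ¬ j < l := fun j l hj hl hjl =>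
    hj.2 ((hmono (Fin.succ_le_castSucc_iff.2 hjl)).trans hl.1)
  rintro ⟨j, hj⟩ ⟨l, hl⟩
  rw [nonempty_subquotient_equiv_iff π hker hS (hcov _)] at hj hl
  exact Subtype.ext (le_antisymm (not_lt.1 (key l j hl hj)) (not_lt.1 (key j l hj hl)))

end Multiplicity

/-! ### Multiplicativity of `†` -/

section Algebra

variable {B W : Type*} [Group W] {M : CoxeterMatrix B} {cs : CoxeterSystem M W}
variable (L : WeightFunction cs)

/-- Induction on length, peeling off a left descent with `dagger_simple_mul`. The purpose is that
the basis `c_w†` has the same structure constants `h_{x,y,z}` as `c_w`. -/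
theorem dagger_mul (x y : H L) : dagger L (x * y) = dagger L x * dagger L y := by
  have h1 : dagger L 1 = 1 := by
    rw [← tT_one L, dagger_tT, tTbar_one, tT_one]; simp
  have key : ∀ n : ℕ, ∀ w : W, cs.length w = n →
      ∀ y, dagger L (tT L w * y) = dagger L (tT L w) * dagger L y := by
    intro n
    induction n with
    | zero =>
      intro w hw y
      rw [cs.length_eq_zero_iff.1 hw, tT_one, h1, one_mul, one_mul]
    | succ n ih =>
      intro w hw y
      have hne : w ≠ 1 := by rintro rfl; simp at hw
      obtain ⟨j, hj⟩ := cs.exists_leftDescent_of_ne_one hne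
      have hj' : cs.length (cs.simple j * w) < cs.length w := hj
      have := cs.length_simple_mul w j
      have e := tT_simple_mul_of_lt L (i := j) (w := cs.simple j * w) (by simpa using hj')
      rw [CoxeterSystem.simple_mul_simple_cancel_left] at e
      rw [← e, mul_assoc, dagger_simple_mul, dagger_simple_mul, ih _ (by omega), mul_assoc]
  have : (LinearMap.mul A (H L)).compr₂ (dagger L) =
      (LinearMap.mul A (H L)).compl₁₂ (dagger L) (dagger L) :=
    (tT L).ext fun w => LinearMap.ext fun y => key _ w rfl y
  exact LinearMap.congr_fun₂ this x y

variable [Fintype W]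

theorem cDagger_mul (x y : W) :
    cDagger L x * cDagger L y = ∑ z, hCoeff L x y z • cDagger L z := by
  simp only [cDagger_apply]
  rw [← dagger_mul, ← (c L).sum_repr (c L x * c L y), map_sum]
  exact Finset.sum_congr rfl fun z _ => map_smul _ _ _

end Algebra

/-! ### Consequences of Lusztig's properties for `γ` and the signs `n̂` -/

namespace LusztigProperties

variable {B W : Type*} [Group W] [Fintype W] {M : CoxeterMatrix B} {cs : CoxeterSystem M W}
variable {L : WeightFunction cs}

theorem existsUnique_gam (hL : LusztigProperties L) (z : W) :
    ∃! d, d ∈ DSet L ∧ gam L z z⁻¹ d ≠ 0 := by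
  simpa using hL.P3 z⁻¹

theorem gam_eq_nCoeff (hL : LusztigProperties L) {z d : W} (hd : d ∈ DSet L)
    (h : gam L z z⁻¹ d ≠ 0) :
    gam L z z⁻¹ d = nCoeff L d ∧ (nCoeff L d = 1 ∨ nCoeff L d = -1) := by
  simpa using hL.P5 d hd z⁻¹ (by simpa using h)

theorem nHat_eq (hL : LusztigProperties L) {z d : W} (hd : d ∈ DSet L)
    (h : gam L z z⁻¹ d ≠ 0) : nHat L z = nCoeff L d := by
  have h1 := Classical.epsilon_spec (p := fun d => d ∈ DSet L ∧ gam L z z⁻¹ d ≠ 0) ⟨d, hd, h⟩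
  rw [nHat, (hL.existsUnique_gam z).unique h1 ⟨hd, h⟩]

theorem nHat_mul_self (hL : LusztigProperties L) (z : W) : nHat L z * nHat L z = 1 := by
  obtain ⟨d, ⟨hd, h⟩, -⟩ := hL.existsUnique_gam z
  rw [hL.nHat_eq hd h]
  rcases (hL.gam_eq_nCoeff hd h).2 with h | h <;> rw [h] <;> norm_num

theorem aFun_inv (hL : LusztigProperties L) (z : W) : aFun L z⁻¹ = aFun L z := by
  obtain ⟨d, ⟨hd, h⟩, -⟩ := hL.existsUnique_gam z
  exact (hL.P8 _ _ _ h).1.symm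

/-- The leading coefficients of P15': associativity of Lusztig's ring `J`. -/
theorem gam_assoc (hL : LusztigProperties L) {x w x' y : W} (h : aFun L w = aFun L y) :
    ∑ u, gam L x u y⁻¹ * gam L w x' u⁻¹ = ∑ u, gam L x w u⁻¹ * gam L u x' y⁻¹ := by
  let φ : A →+ ℤ := AddMonoidHom.mk' (fun f => f.coeff 0) (by simp)
  have coeff_mul_intCast (n : ℤ) (f : A) (i : ℤ) :
      (v i * ((n : A) * f)).coeff 0 = (v i * f).coeff 0 * n := by
    rw [mul_left_comm, ← zsmul_eq_mul, mul_comm _ n, ← smul_eq_mul]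
    exact map_zsmul φ n (v i * f)
  have h0 := congrArg (fun f : A => (v (aFun L y) * f).coeff 0) (hL.P15' x x' y w h)
  simp only [Finset.mul_sum] at h0
  have coeff_sum (f : W → A) : (∑ u, f u).coeff 0 = ∑ u, (f u).coeff 0 := map_sum φ f _
  rw [coeff_sum, coeff_sum] at h0
  simp only [coeff_mul_intCast] at h0
  calc ∑ u, gam L x u y⁻¹ * gam L w x' u⁻¹
      = ∑ u, (v (aFun L y) * hCoeff L x u y).coeff 0 * gam L w x' u⁻¹ := by
        simp only [gam, inv_inv, hL.aFun_inv]
    _ = ∑ u, (v (aFun L y) * hCoeff L x w u).coeff 0 * gam L u x' y⁻¹ := h0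
    _ = ∑ u, gam L x w u⁻¹ * gam L u x' y⁻¹ := by
        refine Finset.sum_congr rfl fun u _ => ?_
        -- The definition of `γ_{x,w,u⁻¹}` uses the power `v^{a(u)}`, not `v^{a(y)}`. By P8 the two
        -- agree whenever the other factor is nonzero.
        by_cases hu : gam L u x' y⁻¹ = 0
        · rw [hu, mul_zero, mul_zero]
        · have h1 := hL.P8 _ _ _ hu
          have h2 : aFun L u = aFun L y := by rw [h1.1, h1.2, hL.aFun_inv]
          rw [show gam L x w u⁻¹ = (v (aFun L y) * hCoeff L x w u).coeff 0 by
            rw [gam, inv_inv, hL.aFun_inv, h2]]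

/-- After a cyclic rotation by P7 this is P2. Elements of `𝒟` thus act on the `t_z` diagonally, like
idempotents up to sign. -/
theorem gam_eq_zero (hL : LusztigProperties L) {d z u : W} (hd : d ∈ DSet L) (h : u ≠ z) :
    gam L d z u⁻¹ = 0 := by
  by_contra h0
  rw [hL.P7] at h0
  exact h (by simpa using (hL.P2 d hd _ _ h0).symm)

/-- Let `d` be the element of `𝒟` attached to `z`. In the associativity relation for `d, z, w` each
side has one surviving term; cancelling `γ_{z,w,y⁻¹}` leaves `γ_{d,y,y⁻¹} = γ_{d,z,z⁻¹}`, so `d` is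
attached to `y` as well. -/
theorem nHat_eq_of_gam_ne_zero (hL : LusztigProperties L) {z w y : W}
    (h : gam L z w y⁻¹ ≠ 0) : nHat L z = nHat L y := by
  obtain ⟨d, ⟨hd, hz⟩, -⟩ := hL.existsUnique_gam z
  have ha := hL.P8 _ _ _ h
  have e := hL.gam_assoc (x := d) (w := z) (x' := w) (y := y)
    (by rw [ha.1, ha.2, hL.aFun_inv])
  rw [Finset.sum_eq_single y (fun u _ hu => by rw [hL.gam_eq_zero hd hu.symm, zero_mul])
      (by simp),
    Finset.sum_eq_single z (fun u _ hu => by rw [hL.gam_eq_zero hd hu, zero_mul]) (by simp),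
    mul_left_inj' h, hL.P7, hL.P7 d z] at e
  rw [hL.nHat_eq hd hz, hL.nHat_eq hd (e ▸ hz)]

open Classical in
/-- The coefficient of `c_y†` in `φ(c_x†) ⋆ c_w†`. -/
theorem sum_hCoeff_mul_gam (hL : LusztigProperties L) (x : W) {w y : W}
    (hy : aFun L y = aFun L w) :
    ∑ z, ∑ d, (if d ∈ DSet L ∧ aFun L z = aFun L d then
      hCoeff L x d z * (nHat L z : A) * (gam L z w y⁻¹ * nHat L w * nHat L y : ℤ) else 0) =
      hCoeff L x w y := by
  obtain ⟨d₀, ⟨hd₀, hw⟩, -⟩ := hL.existsUnique_gam w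
  have ha₀ : aFun L d₀ = aFun L y := by
    have := hL.P8 _ _ _ hw
    rw [hy, this.1, this.2]
  have hyy : (nHat L y : A) * (nHat L y : A) = 1 := by
    exact_mod_cast congrArg (Int.cast : ℤ → A) (hL.nHat_mul_self y)
  have hww : (nHat L w : A) * (nHat L w : A) = 1 := by
    exact_mod_cast congrArg (Int.cast : ℤ → A) (hL.nHat_mul_self w)
  have hterm (d : W) : ∑ z, (if d ∈ DSet L ∧ aFun L z = aFun L d then
      hCoeff L x d z * (nHat L z : A) * (gam L z w y⁻¹ * nHat L w * nHat L y : ℤ) else 0) =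
      if d = d₀ then hCoeff L x w y else 0 := by
    -- If `γ_{z,w,y⁻¹} ≠ 0`, then `a(z) = a(y)` by P8 and `n̂_z n̂_y = 1`. The condition and the
    -- signs therefore no longer depend on `z`, and the sum has the shape required by P15'.
    have hconv : ∀ z, (if d ∈ DSet L ∧ aFun L z = aFun L d then
        hCoeff L x d z * (nHat L z : A) * (gam L z w y⁻¹ * nHat L w * nHat L y : ℤ) else 0) =
        if d ∈ DSet L ∧ aFun L d = aFun L y then
          (nHat L w : A) * ((gam L z w y⁻¹ : A) * hCoeff L x d z) else 0 := by
      intro z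
      by_cases h : gam L z w y⁻¹ = 0
      · simp [h]
      · have ha := hL.P8 _ _ _ h
        have hz : aFun L z = aFun L y := by rw [ha.1, ha.2, hL.aFun_inv]
        rw [hL.nHat_eq_of_gam_ne_zero h]
        refine if_congr (by rw [hz, eq_comm (a := aFun L y)]) ?_ rfl
        push_cast
        linear_combination (gam L z w y⁻¹ : A) * hCoeff L x d z * nHat L w * hyy
    simp only [hconv]
    by_cases hd : d ∈ DSet L ∧ aFun L d = aFun L y
    · simp only [if_pos hd]
      -- P15' turns the sum over `z` into `∑_u γ_{d,w,u⁻¹} h_{x,u,y}`, where only `u = w` survives.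
      -- Its coefficient `γ_{w,w⁻¹,d}` is `n̂_w` for `d = d₀` and zero for every other `d ∈ 𝒟`.
      rw [← Finset.mul_sum, ← hL.P15' x w y d hd.2,
        Finset.sum_eq_single w (fun u _ hu => by rw [hL.gam_eq_zero hd.1 hu]; simp) (by simp),
        hL.P7]
      split_ifs with h
      · rw [h, (hL.gam_eq_nCoeff hd₀ hw).1, ← hL.nHat_eq hd₀ hw, ← mul_assoc, hww, one_mul]
      · have : gam L w w⁻¹ d = 0 := by
          by_contra h0
          exact h ((hL.existsUnique_gam w).unique ⟨hd.1, h0⟩ ⟨hd₀, hw⟩)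
        rw [this]; simp
    · simp only [if_neg hd, Finset.sum_const_zero]
      rw [if_neg (by rintro rfl; exact hd ⟨hd₀, ha₀⟩)]
  rw [Finset.sum_comm]
  simp only [hterm, Finset.sum_ite_eq', Finset.mem_univ, if_true]

end LusztigProperties

/-! ### The action through `φ` is left multiplication on the graded pieces -/

section Specialisation

variable {B W : Type*} [Group W] {M : CoxeterMatrix B} {cs : CoxeterSystem M W}
variable (L : WeightFunction cs) (k : Type*) [Field k] [Algebra A k]

theorem cDaggerK_apply (w : W) : cDaggerK L k w = 1 ⊗ₜ[A] cDagger L w :=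
  Algebra.TensorProduct.basis_apply (cDagger L) w

variable {L} in
theorem cDaggerK_mem_Hge {a : ℕ} {w : W} (h : a ≤ aFun L w) : cDaggerK L k w ∈ Hge L k a :=
  Submodule.subset_span ⟨w, h, rfl⟩

variable {L} in
theorem cls_eq_cls {a : ℕ} {f g : Hge L k a} (h : (f : Hk L k) - g ∈ Hge L k (a + 1)) :
    cls L k a f = cls L k a g :=
  (Submodule.Quotient.eq _).2 h

variable [Fintype W]

theorem cDaggerK_mul (x w : W) : cDaggerK L k x * cDaggerK L k w =
    ∑ z, algebraMap A k (hCoeff L x w z) • cDaggerK L k z := by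
  simp only [cDaggerK_apply]
  rw [Algebra.TensorProduct.tmul_mul_tmul, one_mul, cDagger_mul, TensorProduct.tmul_sum]
  refine Finset.sum_congr rfl fun z _ => ?_
  rw [TensorProduct.tmul_smul, algebraMap_smul]

open Classical in
theorem phiK_cDaggerK (x : W) : phiK L k (cDaggerK L k x) =
    ∑ z, ∑ d, if d ∈ DSet L ∧ aFun L z = aFun L d then
      Finsupp.single z (algebraMap A k (hCoeff L x d z * (nHat L z : A))) else 0 := by
  rw [phiK, cDaggerK_apply, LinearMap.liftBaseChange_tmul, one_smul, LinearMap.comp_apply, phi,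
    Module.Basis.constr_basis, map_sum]
  refine Finset.sum_congr rfl fun z _ => ?_
  rw [map_sum]
  refine Finset.sum_congr rfl fun d _ => ?_
  split_ifs
  · rw [Finsupp.mapRange.linearMap_apply, Finsupp.mapRange_single, Algebra.linearMap_apply]
  · rw [map_zero]

/-- The action `⋆` on representatives in `H_k`. -/
def starK : J L k →ₗ[k] Hk L k →ₗ[k] Hk L k :=
  Finsupp.linearCombination k (starOp L k)

theorem starK_single (z : W) (r : k) (f : Hk L k) :
    starK L k (Finsupp.single z r) f = r • starOp L k z f := by
  rw [starK, Finsupp.linearCombination_single, LinearMap.smul_apply]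

theorem starK_mem (j : J L k) (a : ℕ) {f : Hk L k} (hf : f ∈ Hge L k a) :
    starK L k j f ∈ Hge L k a := by
  induction j using Finsupp.induction_linear with
  | zero => rw [map_zero]; exact Submodule.zero_mem _
  | add x y hx hy => rw [map_add]; exact Submodule.add_mem _ hx hy
  | single z r =>
    rw [starK_single]; exact Submodule.smul_mem _ _ (starOp_mem L k z a f hf)

/-- Moves computations from the quotient `H_k^a` to `H_k`, where the basis `c_w†` is available. -/
theorem jStar_cls (a : ℕ) (j : J L k) (f : Hge L k a) :
    jStar L k a j (cls L k a f) = cls L k a ⟨starK L k j f, starK_mem L k j a f.2⟩ := by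
  induction j using Finsupp.induction_linear with
  | zero =>
    rw [map_zero, LinearMap.zero_apply, eq_comm, Submodule.Quotient.mk_eq_zero]
    change starK L k 0 f ∈ Hge L k (a + 1)
    rw [map_zero]
    exact Submodule.zero_mem _
  | add x y hx hy =>
    rw [map_add, LinearMap.add_apply, hx, hy, cls, cls, ← Submodule.Quotient.mk_add]
    congr 1
    exact Subtype.ext (by simp)
  | single z r =>
    rw [jStar, Finsupp.linearCombination_single, LinearMap.smul_apply, starBasis, cls,
      Submodule.mapQ_apply, ← Submodule.Quotient.mk_smul]
    congr 1
    exact Subtype.ext (starK_single L k z r f).symm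

variable {L}

-- The right side is the part of `c_x† c_w†` on the level `a(y) = a(w)`; the coefficients come from
-- `sum_hCoeff_mul_gam`.
open Classical in
theorem starK_phiK_cDaggerK (hL : LusztigProperties L) (x w : W) :
    starK L k (phiK L k (cDaggerK L k x)) (cDaggerK L k w) =
      ∑ y, if aFun L y = aFun L w then
        algebraMap A k (hCoeff L x w y) • cDaggerK L k y else 0 := by
  have hterm (z d : W) : starK L k (if d ∈ DSet L ∧ aFun L z = aFun L d then
      Finsupp.single z (algebraMap A k (hCoeff L x d z * (nHat L z : A))) else 0)
        (cDaggerK L k w) =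
      ∑ y, if aFun L y = aFun L w then algebraMap A k (if d ∈ DSet L ∧ aFun L z = aFun L d then
        hCoeff L x d z * (nHat L z : A) * (gam L z w y⁻¹ * nHat L w * nHat L y : ℤ) else 0) •
          cDaggerK L k y else 0 := by
    split_ifs
    · rw [starK_single, starOp, Module.Basis.constr_basis, Finset.smul_sum]
      refine Finset.sum_congr rfl fun y _ => ?_
      split_ifs
      · rw [smul_smul, map_mul, map_mul, map_mul, map_intCast (algebraMap A k) (_ * _ * _)]
      · rw [smul_zero]
    · simp
  rw [phiK_cDaggerK]
  simp only [map_sum, LinearMap.sum_apply, hterm]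
  rw [Finset.sum_congr rfl fun z _ => Finset.sum_comm, Finset.sum_comm]
  refine Finset.sum_congr rfl fun y _ => ?_
  split_ifs with hy
  · rw [← hL.sum_hCoeff_mul_gam x hy]
    simp only [map_sum, Finset.sum_smul]
  · simp

theorem cDaggerK_mul_mem (hL : LusztigProperties L) {a : ℕ} {x w : W}
    (h : a ≤ aFun L x ∨ a ≤ aFun L w) : cDaggerK L k x * cDaggerK L k w ∈ Hge L k a := by
  rw [cDaggerK_mul]
  refine Submodule.sum_mem _ fun z _ => ?_
  by_cases h0 : hCoeff L x w z = 0
  · rw [h0, map_zero, zero_smul]; exact Submodule.zero_mem _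
  · have := hL.P4 x w z h0
    exact Submodule.smul_mem _ _ (cDaggerK_mem_Hge k (by omega))

theorem mul_mem_Hge_left (hL : LusztigProperties L) {a : ℕ} (h : Hk L k) {f : Hk L k}
    (hf : f ∈ Hge L k a) : h * f ∈ Hge L k a := by
  have h1 : Hge L k a ≤ (Hge L k a).comap (LinearMap.mulLeft k h) := by
    rw [Hge, Submodule.span_le]
    rintro _ ⟨w, hw, rfl⟩
    have h2 : ⊤ ≤ (Hge L k a).comap (LinearMap.mulRight k (cDaggerK L k w)) := by
      rw [← (cDaggerK L k).span_eq, Submodule.span_le]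
      rintro _ ⟨x, rfl⟩
      exact cDaggerK_mul_mem k hL (Or.inr hw)
    exact h2 (Submodule.mem_top (x := h))
  exact h1 hf

theorem mul_mem_Hge_right (hL : LusztigProperties L) {a : ℕ} {f : Hk L k}
    (hf : f ∈ Hge L k a) (h : Hk L k) : f * h ∈ Hge L k a := by
  have h1 : Hge L k a ≤ (Hge L k a).comap (LinearMap.mulRight k h) := by
    rw [Hge, Submodule.span_le]
    rintro _ ⟨w, hw, rfl⟩
    have h2 : ⊤ ≤ (Hge L k a).comap (LinearMap.mulLeft k (cDaggerK L k w)) := by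
      rw [← (cDaggerK L k).span_eq, Submodule.span_le]
      rintro _ ⟨x, rfl⟩
      exact cDaggerK_mul_mem k hL (Or.inl hw)
    exact h2 (Submodule.mem_top (x := h))
  exact h1 hf

theorem starK_phiK_sub_mul_mem (hL : LusztigProperties L) {a : ℕ} (h : Hk L k) {f : Hk L k}
    (hf : f ∈ Hge L k a) : starK L k (phiK L k h) f - h * f ∈ Hge L k (a + 1) := by
  classical
  -- The difference is bilinear in `h` and `f`, so it suffices to check it on basis elements `c_x†`,
  -- `c_w†` with `a(w) ≥ a`.
  let D : Hk L k →ₗ[k] Hk L k →ₗ[k] Hk L k :=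
    (starK L k).comp (phiK L k) - LinearMap.mul k (Hk L k)
  have h1 : Hge L k a ≤ (Hge L k (a + 1)).comap (D h) := by
    rw [Hge, Submodule.span_le]
    rintro _ ⟨w, hw, rfl⟩
    have h2 : ⊤ ≤ (Hge L k (a + 1)).comap (D.flip (cDaggerK L k w)) := by
      rw [← (cDaggerK L k).span_eq, Submodule.span_le]
      rintro _ ⟨x, rfl⟩
      show starK L k (phiK L k (cDaggerK L k x)) (cDaggerK L k w) -
        cDaggerK L k x * cDaggerK L k w ∈ Hge L k (a + 1)
      rw [starK_phiK_cDaggerK k hL, cDaggerK_mul, ← Finset.sum_sub_distrib]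
      refine Submodule.sum_mem _ fun y _ => ?_
      split_ifs with hy
      · rw [sub_self]; exact Submodule.zero_mem _
      · rw [zero_sub]
        refine Submodule.neg_mem _ ?_
        -- Here `a(y) ≠ a(w)`. If the coefficient is nonzero, P4 gives `a(y) ≥ a(w)`, hence `a(y) ≥
        -- a + 1`.
        by_cases h0 : hCoeff L x w y = 0
        · rw [h0, map_zero, zero_smul]; exact Submodule.zero_mem _
        · have hw' : a ≤ aFun L w := hw
          have := hL.P4 x w y h0
          exact Submodule.smul_mem _ _ (cDaggerK_mem_Hge k (by omega))
    exact h2 (Submodule.mem_top (x := h))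
  exact h1 hf

/-- Left multiplication by `h ∈ H_k` on `H_k^{≥a}`. -/
def mulGe (hL : LusztigProperties L) (a : ℕ) (h : Hk L k) (f : Hge L k a) : Hge L k a :=
  ⟨h * f, mul_mem_Hge_left k hL h f.2⟩

/-- The action through `φ` on `H_k^a` is the action by left multiplication. -/
theorem jStar_phiK_cls (hL : LusztigProperties L) (a : ℕ) (h : Hk L k) (f : Hge L k a) :
    jStar L k a (phiK L k h) (cls L k a f) = cls L k a (mulGe k hL a h f) := by
  rw [jStar_cls]
  exact cls_eq_cls k (starK_phiK_sub_mul_mem k hL h f.2)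

end Specialisation

/-! ### The module `H_k^a ⊗ V`, its evaluation map, and finite generation -/

section TensorProduct

variable {B W : Type*} [Group W] {M : CoxeterMatrix B} {cs : CoxeterSystem M W}
variable {L : WeightFunction cs} (k : Type*) [Field k] [Algebra A k]
variable (V : Type*) [AddCommGroup V] [Module (Hk L k) V] (a : ℕ)

/-- The element `[f] ⊗ m` of `H_k^a ⊗_{H_k} V`. -/
def tensorMk (f : Hge L k a) (m : V) : HgrTensor L k V a :=
  Submodule.Quotient.mk (cls L k a f ⊗ₜ[ℤ] m)

variable {k V a}

theorem HgrTensor.hom_ext {P : Type*} [AddCommGroup P] {φ ψ : HgrTensor L k V a →ₗ[ℤ] P}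
    (h : ∀ f m, φ (tensorMk k V a f m) = ψ (tensorMk k V a f m)) : φ = ψ := by
  refine Submodule.linearMap_qext _ (TensorProduct.ext' fun x m => ?_)
  obtain ⟨f, rfl⟩ := Submodule.Quotient.mk_surjective _ x
  exact h f m

theorem HgrTensor.induction {p : HgrTensor L k V a → Prop}
    (mk : ∀ f m, p (tensorMk k V a f m)) (add : ∀ x y, p x → p y → p (x + y))
    (x : HgrTensor L k V a) : p x := by
  obtain ⟨t, rfl⟩ := Submodule.Quotient.mk_surjective _ x
  induction t using TensorProduct.induction_on with
  | zero =>
    have := mk 0 0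
    rwa [tensorMk, TensorProduct.tmul_zero] at this
  | tmul x m =>
    obtain ⟨f, rfl⟩ := Submodule.Quotient.mk_surjective _ x
    exact mk f m
  | add x y hx hy => exact add _ _ hx hy

theorem tensorMk_add_left (f g : Hge L k a) (m : V) :
    tensorMk k V a (f + g) m = tensorMk k V a f m + tensorMk k V a g m := by
  rw [tensorMk, cls, Submodule.Quotient.mk_add, TensorProduct.add_tmul]; rfl

theorem tensorMk_zero_left (m : V) : tensorMk k V a (0 : Hge L k a) m = 0 := by
  rw [tensorMk, cls, Submodule.Quotient.mk_zero, TensorProduct.zero_tmul]; rfl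

theorem tensorMk_eq_of_eq_mul {f g : Hge L k a} {h : Hk L k} (m : V) (e : (g : Hk L k) = f * h) :
    tensorMk k V a g m = tensorMk k V a f (h • m) :=
  (Submodule.Quotient.eq _).2 (Submodule.subset_span ⟨f, g, h, m, e, rfl⟩)

/-- The map `[f] ↦ (m ↦ f m)` on `H_k^a`, if `H_k^{>a}` acts as zero on `V`. -/
def grAct (hV : ∀ f ∈ Hge L k (a + 1), ∀ m : V, f • m = 0) :
    Hgr L k a →+ Module.End ℤ V :=
  QuotientAddGroup.lift ((Hge L k (a + 1)).submoduleOf (Hge L k a)).toAddSubgroup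
    ((Module.toModuleEnd ℤ (S := Hk L k) V).toAddMonoidHom.comp
      (Hge L k a).subtype.toAddMonoidHom)
    fun f hf => LinearMap.ext fun m => hV f hf m

/-- The map `[f] ⊗ m ↦ f m`. -/
def evalTensor (hV : ∀ f ∈ Hge L k (a + 1), ∀ m : V, f • m = 0) :
    HgrTensor L k V a →ₗ[ℤ] V :=
  (tensorRel L k V a).liftQ (TensorProduct.lift (grAct hV).toIntLinearMap) <| by
    rw [tensorRel, Submodule.span_le]
    rintro _ ⟨f, g, h, m, e, rfl⟩
    refine (map_sub (TensorProduct.lift (grAct hV).toIntLinearMap) _ _).trans (sub_eq_zero.2 ?_)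
    change (g : Hk L k) • m = (f : Hk L k) • h • m
    rw [e, mul_smul]

theorem evalTensor_tensorMk (hV : ∀ f ∈ Hge L k (a + 1), ∀ m : V, f • m = 0)
    (f : Hge L k a) (m : V) : evalTensor hV (tensorMk k V a f m) = (f : Hk L k) • m :=
  rfl

variable [Fintype W]

/-- The action of `H_k` on `H_k^a ⊗_{H_k} V` through `φ` and `⋆`. -/
def tensorAct (hL : LusztigProperties L) (h : Hk L k) : Module.End ℤ (HgrTensor L k V a) :=
  Submodule.mapQ _ _
    (LinearMap.rTensor V (jStar L k a (phiK L k h)).toAddMonoidHom.toIntLinearMap) <| by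
    rw [tensorRel, Submodule.span_le]
    rintro _ ⟨f, g, h', m, e, rfl⟩
    change LinearMap.rTensor V (jStar L k a (phiK L k h)).toAddMonoidHom.toIntLinearMap
      (_ - _) ∈ tensorRel L k V a
    rw [map_sub]
    change jStar L k a (phiK L k h) (cls L k a g) ⊗ₜ[ℤ] m -
      jStar L k a (phiK L k h) (cls L k a f) ⊗ₜ[ℤ] (h' • m) ∈ tensorRel L k V a
    -- As left multiplication commutes with right multiplication, the relation for `f, g, h', m`
    -- goes to the one for `h f, h g, h', m`.
    rw [jStar_phiK_cls k hL, jStar_phiK_cls k hL]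
    refine Submodule.subset_span ⟨mulGe k hL a h f, mulGe k hL a h g, h', m, ?_, rfl⟩
    change h * (g : Hk L k) = h * f * h'
    rw [e, mul_assoc]

theorem tensorAct_tensorMk (hL : LusztigProperties L) (h : Hk L k) (f : Hge L k a) (m : V) :
    tensorAct hL h (tensorMk k V a f m) = tensorMk k V a (mulGe k hL a h f) m := by
  rw [tensorMk, tensorMk, ← jStar_phiK_cls]
  rfl

variable (V a) in
/-- `tensorAct` as a ring homomorphism. -/
def tensorActHom (hL : LusztigProperties L) : Hk L k →+* Module.End ℤ (HgrTensor L k V a) where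
  toFun := tensorAct hL
  map_one' := HgrTensor.hom_ext fun f m => by
    rw [tensorAct_tensorMk, Module.End.one_apply]
    congr 1
    exact Subtype.ext (one_mul _)
  map_mul' h h' := HgrTensor.hom_ext fun f m => by
    rw [Module.End.mul_apply]
    simp only [tensorAct_tensorMk]
    congr 1
    exact Subtype.ext (mul_assoc _ _ _)
  map_zero' := HgrTensor.hom_ext fun f m => by
    rw [tensorAct_tensorMk, LinearMap.zero_apply, ← tensorMk_zero_left (L := L) (k := k) m]
    congr 1
    exact Subtype.ext (zero_mul _)
  map_add' h h' := HgrTensor.hom_ext fun f m => by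
    rw [LinearMap.add_apply]
    simp only [tensorAct_tensorMk]
    rw [← tensorMk_add_left]
    congr 1
    exact Subtype.ext (add_mul _ _ _)

variable (V a) in
/-- The `H_k`-module structure on `H_k^a ⊗_{H_k} V` through `φ` and `⋆`. -/
@[reducible]
def tensorModule (hL : LusztigProperties L) : Module (Hk L k) (HgrTensor L k V a) :=
  Module.compHom _ (tensorActHom V a hL)

theorem evalTensor_tensorAct (hL : LusztigProperties L)
    (hV : ∀ f ∈ Hge L k (a + 1), ∀ m : V, f • m = 0) (h : Hk L k) (x : HgrTensor L k V a) :
    evalTensor hV (tensorAct hL h x) = h • evalTensor hV x := by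
  induction x using HgrTensor.induction with
  | mk f m =>
    rw [tensorAct_tensorMk, evalTensor_tensorMk, evalTensor_tensorMk, ← mul_smul]
    rfl
  | add x y hx hy => rw [map_add, map_add, map_add, smul_add, hx, hy]

/-- Elements of `H_k^{≥a}` act on `H_k^a ⊗_{H_k} V` through the evaluation map to `V`. -/
theorem tensorAct_eq_tensorMk_evalTensor (hL : LusztigProperties L)
    (hV : ∀ f ∈ Hge L k (a + 1), ∀ m : V, f • m = 0) (f : Hge L k a) (x : HgrTensor L k V a) :
    tensorAct hL (f : Hk L k) x = tensorMk k V a f (evalTensor hV x) := by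
  induction x using HgrTensor.induction with
  | mk g m =>
    rw [tensorAct_tensorMk, evalTensor_tensorMk]
    -- The left tensor factor `g` is itself an element of `H_k`, so it can cross the tensor sign:
    -- `[f g] ⊗ m = [f] ⊗ g m`.
    exact tensorMk_eq_of_eq_mul (h := (g : Hk L k)) m rfl
  | add x y hx hy =>
    rw [map_add, map_add, hx, hy, tensorMk, tensorMk, tensorMk, TensorProduct.tmul_add]
    rfl

-- Since `V = H_k m₀`, every `[f] ⊗ h m₀` equals `[f h] ⊗ m₀`; the finitely many `[c_w†] ⊗ m₀` with
-- `a(w) ≥ a` therefore generate.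
open Classical in
theorem finite_tensorModule (hL : LusztigProperties L) [IsSimpleModule (Hk L k) V] :
    letI := tensorModule (k := k) V a hL
    Module.Finite (Hk L k) (HgrTensor L k V a) := by
  let _ := tensorModule (k := k) V a hL
  have hsmul (h : Hk L k) (f : Hge L k a) (m : V) :
    h • tensorMk k V a f m = tensorMk k V a (mulGe k hL a h f) m := tensorAct_tensorMk hL h f m
  have := IsSimpleModule.nontrivial (Hk L k) V
  obtain ⟨m₀, hm₀⟩ := exists_ne (0 : V)
  let s : Finset (HgrTensor L k V a) := Finset.univ.image fun w =>
    if h : a ≤ aFun L w then tensorMk k V a (cDaggerGe L k a w h) m₀ else 0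
  refine ⟨⟨s, eq_top_iff.2 fun x _ => ?_⟩⟩
  have key (f : Hk L k) (hf : f ∈ Hge L k a) :
      tensorMk k V a ⟨f, hf⟩ m₀ ∈ Submodule.span (Hk L k) (s : Set (HgrTensor L k V a)) := by
    refine Submodule.span_induction (p := fun f hf => tensorMk k V a ⟨f, hf⟩ m₀ ∈
      Submodule.span (Hk L k) (s : Set (HgrTensor L k V a))) ?_ ?_ ?_ ?_ hf
    · rintro _ ⟨w, hw, rfl⟩
      refine Submodule.subset_span (Finset.mem_coe.2 (Finset.mem_image.2
        ⟨w, Finset.mem_univ _, ?_⟩))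
      exact dif_pos (show a ≤ aFun L w from hw)
    · exact (tensorMk_zero_left m₀ : tensorMk k V a (0 : Hge L k a) m₀ = 0) ▸ Submodule.zero_mem _
    · intro f g hf hg h1 h2
      exact (tensorMk_add_left ⟨f, hf⟩ ⟨g, hg⟩ m₀) ▸ Submodule.add_mem _ h1 h2
    · intro r f hf h1
      -- The tensor product is taken over `ℤ` and carries only the action of `H_k`, so scalars of
      -- `k` enter as left multiplication by their images in `H_k`.
      have e : (⟨r • f, Submodule.smul_mem _ r hf⟩ : Hge L k a) =
          mulGe k hL a (algebraMap k (Hk L k) r) ⟨f, hf⟩ :=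
        Subtype.ext (Algebra.smul_def r f)
      exact e ▸ hsmul _ _ _ ▸ Submodule.smul_mem _ _ h1
  induction x using HgrTensor.induction with
  | mk f m =>
    obtain ⟨h, rfl⟩ := IsSimpleModule.toSpanSingleton_surjective (Hk L k) hm₀ m
    have := tensorMk_eq_of_eq_mul (f := f) (g := ⟨f * h, mul_mem_Hge_right k hL f.2 h⟩) m₀ rfl
    exact this ▸ key _ _
  | add x y hx hy => exact Submodule.add_mem _ (hx trivial) (hy trivial)

end TensorProduct

/-! ### The invariant `α_V` is attained -/

section Alpha

variable {B W : Type*} [Group W] [Fintype W] {M : CoxeterMatrix B} {cs : CoxeterSystem M W}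
variable (L : WeightFunction cs) (k : Type*) [Field k] [Algebra A k]
variable (V : Type*) [AddCommGroup V] [Module (Hk L k) V]

theorem bddAbove_alpha :
    BddAbove {n | ∃ w : W, aFun L w = n ∧ ∃ m : V, cDaggerK L k w • m ≠ 0} :=
  ((Set.finite_range (aFun L)).subset (by rintro _ ⟨w, rfl, -⟩; exact ⟨w, rfl⟩)).bddAbove

/-- The set of values is finite, and nonempty because `1` is a combination of the `c_w†`, which
therefore cannot all kill `V`. For `V = 0` the supremum would be the default value `0` of an empty
set. -/
theorem exists_aFun_eq_alpha [Nontrivial V] :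
    ∃ w : W, aFun L w = alpha L k V ∧ ∃ m : V, cDaggerK L k w • m ≠ 0 := by
  refine Nat.sSup_mem ?_ (bddAbove_alpha L k V)
  obtain ⟨m, hm⟩ := exists_ne (0 : V)
  by_contra hno
  have hno' (w : W) : cDaggerK L k w • m = 0 := by
    by_contra hw
    exact hno ⟨_, w, rfl, m, hw⟩
  refine hm ?_
  rw [← one_smul (Hk L k) m, ← (cDaggerK L k).sum_repr 1, Finset.sum_smul]
  refine Finset.sum_eq_zero fun w _ => ?_
  rw [Algebra.smul_def, mul_smul, hno', smul_zero]

variable {L k V} in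
theorem smul_eq_zero_of_alpha_lt {f : Hk L k} (hf : f ∈ Hge L k (alpha L k V + 1)) (m : V) :
    f • m = 0 := by
  induction hf using Submodule.span_induction with
  | mem f hf =>
    obtain ⟨w, hw, rfl⟩ := hf
    by_contra h0
    have : aFun L w ≤ alpha L k V := le_csSup (bddAbove_alpha L k V) ⟨w, rfl, m, h0⟩
    have hw' : alpha L k V + 1 ≤ aFun L w := hw
    omega
  | zero => exact zero_smul _ _
  | add f g _ _ hf hg => rw [add_smul, hf, hg, add_zero]
  | smul r f _ hf => rw [Algebra.smul_def, mul_smul, hf, smul_zero]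

end Alpha

end IwahoriHecke

end

/-! ### The main theorem -/

open IwahoriHecke in
theorem mainTheorem6 {B W : Type*} [Group W] [Fintype W] {M : CoxeterMatrix B}
    (cs : CoxeterSystem M W)
    (hWeyl : ∀ i j : B, i ≠ j → M i j = 2 ∨ M i j = 3 ∨ M i j = 4 ∨ M i j = 6)
    (L : WeightFunction cs) (hL : LusztigProperties L)
    (k : Type*) [Field k] [Algebra A k]
    (V : Type*) [AddCommGroup V] [Module (Hk L k) V] [IsSimpleModule (Hk L k) V] :
    ∃ _ : Module (Hk L k) (Tilde L k V),
      (∀ (h : Hk L k) (x : Hgr L k (alpha L k V)) (m : V),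
        h • tildeMk L k V x m = tildeMk L k V (jStar L k (alpha L k V) (phiK L k h) x) m) ∧
      ∃ π : Tilde L k V →ₗ[Hk L k] V,
        (∀ (f : Hge L k (alpha L k V)) (m : V),
          π (tildeMk L k V (cls L k (alpha L k V) f) m) = (f : Hk L k) • m) ∧
        Function.Surjective π ∧
        (∀ (V' : Type*) [AddCommGroup V'] [Module (Hk L k) V'],
          IsCompositionFactor (Hk L k) (LinearMap.ker π) V' →
            alpha L k V' < alpha L k V) ∧
        HasMultiplicity (Hk L k) (Tilde L k V) V 1 := by
  have hV (f : Hk L k) (hf : f ∈ Hge L k (alpha L k V + 1)) (m : V) : f • m = 0 :=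
    smul_eq_zero_of_alpha_lt hf m
  let _ := tensorModule (k := k) V (alpha L k V) hL
  let π : Tilde L k V →ₗ[Hk L k] V :=
    { toFun := evalTensor hV
      map_add' := map_add _
      map_smul' := evalTensor_tensorAct hL hV }
  -- The whole ideal `Hge a` kills `ker π`, because `f x = [f] ⊗ π(x)`.
  have hker (f : Hk L k) (hf : f ∈ Hge L k (alpha L k V)) (x : Tilde L k V)
      (hx : x ∈ LinearMap.ker π) : f • x = 0 := by
    refine (tensorAct_eq_tensorMk_evalTensor hL hV ⟨f, hf⟩ x).trans ?_
    rw [show evalTensor hV x = 0 from hx, tensorMk, TensorProduct.tmul_zero]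
    rfl
  have := IsSimpleModule.nontrivial (Hk L k) V
  obtain ⟨w, hw, m, hm⟩ := exists_aFun_eq_alpha L k V
  have hsurj : Function.Surjective π := by
    refine LinearMap.surjective_of_ne_zero fun h0 => hm ?_
    exact LinearMap.congr_fun h0
      (tensorMk k V _ ⟨cDaggerK L k w, cDaggerK_mem_Hge k hw.ge⟩ m)
  have : Module.Finite k (Hk L k) := Module.Finite.of_basis (cDaggerK L k)
  -- A finitely generated module over an Artinian ring is both Noetherian and Artinian, as
  -- `hasMultiplicity_one` requires.
  have : IsArtinianRing (Hk L k) := IsArtinianRing.of_finite k (Hk L k)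
  have : Module.Finite (Hk L k) (Tilde L k V) := finite_tensorModule hL
  refine ⟨inferInstance, fun h x m => rfl, π, fun f m => rfl, hsurj, ?_,
    hasMultiplicity_one π hsurj (hker _ (cDaggerK_mem_Hge k hw.ge)) ⟨m, hm⟩⟩
  rintro V' _ _ ⟨_, N₁, N₂, -, ⟨e⟩⟩
  have := IsSimpleModule.nontrivial (Hk L k) V'
  obtain ⟨w', hw', m', hm'⟩ := exists_aFun_eq_alpha L k V'
  -- If `α_{V'} ≥ α_V`, the element `c_{w'}†` that realises `α_{V'}` lies in `Hge a`. It then kills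
  -- `ker π` and all its subquotients, contradicting `hm'`.
  by_contra! hlt
  refine hm' (smul_eq_zero_of_subquotient e (fun x _ => ?_) m')
  rw [show cDaggerK L k w' • x = 0 from
    Subtype.ext (hker _ (cDaggerK_mem_Hge k (hw' ▸ hlt)) x.1 x.2)]
  exact N₁.zero_mem
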